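/- Let $\mathbb{H}^2$ be the hyperbolic plane. For a line $L$ supporting a convex body $C\subset\mathbb{H}^2$, the width of $C$ determined by $L$ is the distance between $L$ and a farthest line that supports $C$ and is ultraparallel to $L$; the thickness $\Delta(C)$ is the minimum of these widths over all lines $L$ supporting $C$. A convex $n$-gon $V=v_1v_2\dots v_n\subset\mathbb{H}^2$ with $n\ge 3$ odd (vertices listed successively around the boundary in positive orientation, indices modulo $n$) is called an ordinary reduced polygon if, for every $i\in\{1,\dots,n\}$, the orthogonal projection of $v_i$ on the line $L_i$ containing the side $v_{i+(n-1)/2}v_{i+(n+1)/2}$ lies in the relative interior of this side, and the distance between $v_i$ and $L_i$ is $\Delta(V)$. Then for every ordinary reduced polygon $V\subset\mathbb{H}^2$, $$\operatorname{diam}(V)<\operatorname{arccosh}\left(\sqrt{1+\tfrac13\sinh^2\Delta(V)}\cdot\cosh\Delta(V)\right).$$ -/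

import Mathlib

/-- The hyperbolic plane in the hyperboloid model: the upper sheet
`t = √(x ^ 2 + y ^ 2 + 1)` of the two-sheeted hyperboloid in `ℝ³`. -/
@[ext]
structure HypPlane where
  x : ℝ
  y : ℝ
  t : ℝ
  sheet : t = Real.sqrt (x ^ 2 + y ^ 2 + 1)

namespace HypPlane

/-- Minus the Lorentz product of two points; it is the hyperbolic cosine of their distance. -/
def lorentz (p q : HypPlane) : ℝ := p.t * q.t - p.x * q.x - p.y * q.y

/-- The hyperbolic distance `arcosh (t t' - x x' - y y')`. -/
noncomputable instance : Dist HypPlane := ⟨fun p q => Real.arcosh (lorentz p q)⟩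

theorem dist_def (p q : HypPlane) : dist p q = Real.arcosh (lorentz p q) := rfl

theorem t_sq (p : HypPlane) : p.t ^ 2 = p.x ^ 2 + p.y ^ 2 + 1 := by
  rw [p.sheet, Real.sq_sqrt (by positivity)]

theorem t_pos (p : HypPlane) : 0 < p.t := by
  rw [p.sheet]; positivity

theorem t_sub_x_pos (p : HypPlane) : 0 < p.t - p.x := by
  have h := p.t_sq
  have h' := p.t_pos
  by_contra hc
  nlinarith [sq_nonneg p.y]

/-- The standard isometry from the hyperboloid onto Mathlib's upper half-plane; it serves only
to transport the axioms of a metric. -/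
noncomputable def toUpperHalfPlane (p : HypPlane) : UpperHalfPlane :=
  ⟨⟨p.y / (p.t - p.x), 1 / (p.t - p.x)⟩, one_div_pos.mpr p.t_sub_x_pos⟩

theorem dist_eq_upperHalfPlane (p q : HypPlane) :
    dist p q = dist p.toUpperHalfPlane q.toUpperHalfPlane := by
  have hp := p.t_sub_x_pos
  have hq := q.t_sub_x_pos
  have h1 := p.t_sq
  have h2 := q.t_sq
  have key : lorentz p q = Real.cosh (dist p.toUpperHalfPlane q.toUpperHalfPlane) := by
    rw [UpperHalfPlane.cosh_dist, Complex.dist_eq, ← Complex.normSq_eq_norm_sq,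
      Complex.normSq_apply]
    simp only [toUpperHalfPlane, UpperHalfPlane.coe_mk, UpperHalfPlane.im, Complex.sub_re,
      Complex.sub_im, lorentz]
    field_simp
    linear_combination (q.t - q.x) ^ 2 * h1 + (p.t - p.x) ^ 2 * h2
  rw [dist_def, key, Real.arcosh_cosh dist_nonneg]

/-- The hyperbolic plane as a metric space, with the distance above. -/
noncomputable instance : MetricSpace HypPlane where
  dist_self p := by rw [dist_eq_upperHalfPlane, dist_self]
  dist_comm p q := by rw [dist_eq_upperHalfPlane, dist_comm, ← dist_eq_upperHalfPlane]
  dist_triangle p q r := by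
    simp only [dist_eq_upperHalfPlane]; exact dist_triangle _ _ _
  eq_of_dist_eq_zero := by
    intro p q h
    rw [dist_eq_upperHalfPlane, dist_eq_zero] at h
    have hp := p.t_sub_x_pos
    have hq := q.t_sub_x_pos
    have h1 := p.t_sq
    have h2 := q.t_sq
    have him : 1 / (p.t - p.x) = 1 / (q.t - q.x) := congrArg UpperHalfPlane.im h
    have hre : p.y / (p.t - p.x) = q.y / (q.t - q.x) := congrArg UpperHalfPlane.re h
    have e : p.t - p.x = q.t - q.x := by
      simpa using him
    rw [e] at hre
    have ey : p.y = q.y := by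
      field_simp at hre
      exact hre
    have es : p.t + p.x = q.t + q.x := by
      have : (q.t - q.x) * (p.t + p.x) = (q.t - q.x) * (q.t + q.x) := by
        have h3 : p.y ^ 2 = q.y ^ 2 := by rw [ey]
        calc (q.t - q.x) * (p.t + p.x) = (p.t - p.x) * (p.t + p.x) := by rw [e]
          _ = (q.t - q.x) * (q.t + q.x) := by linear_combination h1 - h2 + h3
      exact mul_left_cancel₀ hq.ne' this
    ext <;> linarith

/-- The determinant of three points of the hyperboloid as vectors of `ℝ³`. It vanishes when they
lie on a common hyperbolic line, and for `p ≠ q` it is positive exactly when `r` lies strictly to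
the left of the line through `p` and `q`, directed from `p` to `q`. -/
def det (p q r : HypPlane) : ℝ :=
  p.x * (q.y * r.t - q.t * r.y) - p.y * (q.x * r.t - q.t * r.x) + p.t * (q.x * r.y - q.y * r.x)

/-- The hyperbolic line through two different points `p` and `q`. -/
def lineThrough (p q : HypPlane) : Set HypPlane := {r | det p q r = 0}

/-- The geodesic segment joining `p` and `q`: the points of the hyperboloid that are nonnegative
combinations of `p` and `q`. -/
def segment (p q : HypPlane) : Set HypPlane :=
  {r | ∃ a b : ℝ, 0 ≤ a ∧ 0 ≤ b ∧
    r.x = a * p.x + b * q.x ∧ r.y = a * p.y + b * q.y ∧ r.t = a * p.t + b * q.t}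

/-- The relative interior of the segment joining two different points `p` and `q`. -/
def openSegment (p q : HypPlane) : Set HypPlane :=
  {r | ∃ a b : ℝ, 0 < a ∧ 0 < b ∧
    r.x = a * p.x + b * q.x ∧ r.y = a * p.y + b * q.y ∧ r.t = a * p.t + b * q.t}

/-- (Geodesic) convexity. -/
def IsConvex (S : Set HypPlane) : Prop := ∀ p ∈ S, ∀ q ∈ S, segment p q ⊆ S

/-- The convex hull of a set. -/
def hull (S : Set HypPlane) : Set HypPlane := ⋂₀ {K | IsConvex K ∧ S ⊆ K}

/-- `L` is a line supporting `C`: it bounds a closed half-plane that contains `C`, and it meets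
`C`. The lines are the sections of the hyperboloid by the planes `a x + b y = c t` with
`c ^ 2 < a ^ 2 + b ^ 2`. -/
def Supports (L C : Set HypPlane) : Prop :=
  (∃ a b c : ℝ, c ^ 2 < a ^ 2 + b ^ 2 ∧ L = {p | a * p.x + b * p.y = c * p.t} ∧
    C ⊆ {p | a * p.x + b * p.y ≤ c * p.t}) ∧ (L ∩ C).Nonempty

/-- The distance between two nonempty sets: the infimum of the distances of their points. -/
noncomputable def setDist (L M : Set HypPlane) : ℝ := sInf (Set.image2 dist L M)

/-- Two lines are ultraparallel if they neither intersect nor share an ideal point, that is, if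
the distance between them is positive. -/
def Ultraparallel (L M : Set HypPlane) : Prop := 0 < setDist L M

/-- The width of `C` determined by its supporting line `L`: the distance between `L` and a
farthest line that supports `C` and is ultraparallel to `L`. -/
noncomputable def width (L C : Set HypPlane) : ℝ :=
  sSup {d | ∃ M, Supports M C ∧ Ultraparallel L M ∧ d = setDist L M}

/-- The thickness of `C`: the infimum of its widths over all supporting lines. -/
noncomputable def thickness (C : Set HypPlane) : ℝ :=
  sInf {w | ∃ L, Supports L C ∧ w = width L C}

/-- `p` is the projection of `z` on the line `L`: the point of `L` nearest to `z`. -/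
def IsProjection (z : HypPlane) (L : Set HypPlane) (p : HypPlane) : Prop :=
  p ∈ L ∧ dist z p = Metric.infDist z L

/-- `v` lists the successive vertices of a convex `n`-gon in positive orientation, with indices
modulo `n`: no vertex is in the convex hull of the others, and all vertices other than `v i` and
`v (i + 1)` lie strictly to the left of the directed line from `v i` to `v (i + 1)`. -/
structure IsConvexPolygon {n : ℕ} (v : ZMod n → HypPlane) : Prop where
  three_le : 3 ≤ n
  vertex : ∀ i, v i ∉ hull (v '' {j | j ≠ i})
  successive : ∀ i j, j ≠ i → j ≠ i + 1 → 0 < det (v i) (v (i + 1)) (v j)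

/-- `V` is an ordinary reduced polygon: a convex `n`-gon `v₁ … vₙ` with `n` odd such that, for
every `i`, the projection of `vᵢ` on the line containing the opposite side, whose ends are the
vertices with indices `i + (n - 1) / 2` and `i + (n + 1) / 2`, is in the relative interior of this
side, and the distance between `vᵢ` and this line is the thickness of `V`. -/
def IsOrdinaryReducedPolygon (V : Set HypPlane) : Prop :=
  ∃ (n : ℕ) (v : ZMod n → HypPlane), Odd n ∧ IsConvexPolygon v ∧ V = hull (Set.range v) ∧
    ∀ i : ZMod n,
      let a : HypPlane := v (i + (((n - 1) / 2 : ℕ) : ZMod n))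
      let b : HypPlane := v (i + (((n + 1) / 2 : ℕ) : ZMod n))
      (∃ p, IsProjection (v i) (lineThrough a b) p ∧ p ∈ openSegment a b) ∧
        Metric.infDist (v i) (lineThrough a b) = thickness V

end HypPlane

/-! Write `Δ = 2 * c`; of the thickness, only the fact that it is the common length of all altitudes
matters. The diameter is the distance of two vertices. List the vertices so that each is opposite to
the side joining its two neighbours in the list. Two successive altitudes belong to right triangles
with a common hypotenuse and equal legs `Δ`, so they cross symmetrically, at distance `c - q` from
both feet and `c + q` from both vertices (`exists_crossing`). An altitude can thus be carried around
the polygon by turns about successive crossing points; at each turn its two ends exchange the roles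
of vertex and foot.

Suppose that the diameter, attained at `a` and `b`, is not below the bound. The functional of `N = b
- a` vanishes on the perpendicular bisector of `a b` and is positive on the side of `b`. Carry the
altitude from `b` to the altitude from `a`: the lower end goes from the positive side to the
negative one, while the upper end, which follows the boundary, changes side at most once, to the
positive one (`AltitudeCycle.mono`).

Follow the point of the altitude at distance `c + q₀` from the lower end, where `q₀` is at least
every `q`. As long as the upper end is not on the positive side, the tilt against the bisector does
not decrease (`SwingStep.tilt_mono`). This keeps the followed point, and with it the lower end, off
the negative side (`Good.swing_up`, `Good.swing_down`). The same holds backwards from `a` with signs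
reversed. At the turn where the upper end changes side, the two runs give incompatible signs at the
centre of rotation (`Sweep.false`).

The large diameter supplies the bounds at both starts (`good_start`). The constant `1/3` comes from
the condition `sinh (2 * c) < 3 * sinh (2 * q₀)`, under which `Good.swing_up` works. -/

namespace HypPlane

open Real

/-! ### Turning a line about successive centres -/

/-- A directed line turns about one of its points. The triples `(Z, Y, E)` and `(Z', Y', E')`
record the position of a fixed line relative to a frame of the moving line before and after; the
frames are at the distances `ρ` and `ρ'` beyond the centre, and `κ` is the tangent of half the
angle. -/
structure SwingStep (ρ ρ' κ Z Y E Z' Y' E' : ℝ) : Prop where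
  center : Z * cosh ρ + Y * sinh ρ = Z' * cosh ρ' + Y' * sinh ρ'
  slope : (1 + κ ^ 2) * (Z' * sinh ρ' + Y' * cosh ρ') =
    (1 - κ ^ 2) * (Z * sinh ρ + Y * cosh ρ) - 2 * κ * E
  tilt : (1 + κ ^ 2) * E' = (1 - κ ^ 2) * E + 2 * κ * (Z * sinh ρ + Y * cosh ρ)

/-- Inverting the rotation changes the sign of `κ`; negating `Z` and `Y` restores it. -/
theorem SwingStep.reverse {ρ ρ' κ Z Y E Z' Y' E' : ℝ}
    (h : SwingStep ρ ρ' κ Z Y E Z' Y' E') :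
    SwingStep ρ' ρ κ (-Z') (-Y') E' (-Z) (-Y) E := by
  have hp : (1 + κ ^ 2) ≠ 0 := by positivity
  obtain ⟨h1, h2, h3⟩ := h
  refine ⟨by linarith, ?_, ?_⟩
  · apply mul_left_cancel₀ hp
    linear_combination (1 - κ ^ 2) * h2 + 2 * κ * h3
  · apply mul_left_cancel₀ hp
    linear_combination -(1 - κ ^ 2) * h3 + 2 * κ * h2

theorem SwingStep.position {ρ ρ' κ Z Y E Z' Y' E' : ℝ}
    (h : SwingStep ρ ρ' κ Z Y E Z' Y' E') :
    (1 + κ ^ 2) * Z' = Z * (cosh (ρ' - ρ) + κ ^ 2 * cosh (ρ + ρ'))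
      - Y * (sinh (ρ' - ρ) - κ ^ 2 * sinh (ρ + ρ')) + 2 * κ * E * sinh ρ' := by
  obtain ⟨h1, h2, -⟩ := h
  rw [cosh_sub, sinh_sub, cosh_add, sinh_add]
  have hc := cosh_sq ρ'
  linear_combination (-(1 + κ ^ 2) * cosh ρ') * h1 - sinh ρ' * h2 - (1 + κ ^ 2) * Z' * hc

/-- While the upper end stays on the near side, the tilt does not decrease. -/
theorem SwingStep.tilt_mono {ρ ρ' κ Z Y E Z' Y' E' τ : ℝ}
    (h : SwingStep ρ ρ' κ Z Y E Z' Y' E') (hρ : 0 ≤ ρ) (hρ' : 0 ≤ ρ') (hτ : 0 < τ)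
    (hκ : 0 < κ) (hZ : 0 ≤ Z) (hY : 0 ≤ Y) (hE : 0 < E)
    (hU : Z' * cosh τ - Y' * sinh τ ≤ 0) : E ≤ E' := by
  have hs : 0 < sinh (τ + ρ') := sinh_pos_iff.2 (by linarith)
  have hO : 0 ≤ Z * cosh ρ + Y * sinh ρ :=
    add_nonneg (mul_nonneg hZ (cosh_pos _).le) (mul_nonneg hY (sinh_nonneg_iff.2 hρ))
  have hW : 0 ≤ Z * sinh ρ + Y * cosh ρ :=
    add_nonneg (mul_nonneg hZ (sinh_nonneg_iff.2 hρ)) (mul_nonneg hY (cosh_pos _).le)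
  obtain ⟨h1, h2, h3⟩ := h
  -- The value at the upper end, seen from the centre at distance `τ + ρ'`. It is not positive while
  -- the value at the centre is not negative, which fixes the sign of the slope after the turn.
  have hU' : Z' * cosh τ - Y' * sinh τ = (Z' * cosh ρ' + Y' * sinh ρ') * cosh (τ + ρ')
      - (Z' * sinh ρ' + Y' * cosh ρ') * sinh (τ + ρ') := by
    rw [cosh_add, sinh_add]
    have hc := cosh_sq ρ'
    linear_combination -(Z' * cosh τ - Y' * sinh τ) * hc
  have hW' : 0 ≤ Z' * sinh ρ' + Y' * cosh ρ' := by
    have h5 : 0 ≤ (Z' * cosh ρ' + Y' * sinh ρ') * cosh (τ + ρ') :=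
      mul_nonneg (h1 ▸ hO) (cosh_pos _).le
    by_contra hn
    push Not at hn
    nlinarith [mul_pos (neg_pos.2 hn) hs]
  have h6 : 2 * κ * E ≤ (1 - κ ^ 2) * (Z * sinh ρ + Y * cosh ρ) := by
    have : 0 ≤ (1 + κ ^ 2) * (Z' * sinh ρ' + Y' * cosh ρ') := by positivity
    linarith
  have h7 : 2 * κ * E ≤ Z * sinh ρ + Y * cosh ρ := by
    nlinarith [mul_nonneg (sq_nonneg κ) hW]
  have hp : 0 < 1 + κ ^ 2 := by positivity
  have h8 : 0 ≤ (1 + κ ^ 2) * (E' - E) := by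
    have : 0 ≤ 2 * κ * (Z * sinh ρ + Y * cosh ρ - κ * E) := by
      have : 0 < κ * E := by positivity
      have : 0 ≤ Z * sinh ρ + Y * cosh ρ - κ * E := by linarith
      positivity
    nlinarith
  nlinarith [nonneg_of_mul_nonneg_right h8 hp]

/-- `(Z, Y, E)` satisfies the bounds that are kept along the sweep. -/
structure Good (S q₀ ν Z Y E : ℝ) : Prop where
  tilt_pos : 0 < E
  tilt_bound : sinh (2 * q₀) * ν ≤ E ^ 2 * (S + sinh (2 * q₀))
  norm : Y ^ 2 + E ^ 2 - Z ^ 2 = ν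
  position : 0 ≤ Z

theorem sinh_mul_sinh_le (a b : ℝ) : sinh (2 * a) * sinh (2 * b) ≤ sinh (a + b) ^ 2 := by
  have h1 := cosh_sub (2 * a) (2 * b)
  have h2 := cosh_add (2 * a) (2 * b)
  have h3 : cosh (2 * a + 2 * b) = 1 + 2 * sinh (a + b) ^ 2 := by
    rw [show 2 * a + 2 * b = 2 * (a + b) by ring, cosh_two_mul, cosh_sq]; ring
  nlinarith [one_le_cosh (2 * a - 2 * b)]

theorem nonneg_of_upper_nonpos {τ Z Y : ℝ} (hτ : 0 < τ) (hZ : 0 ≤ Z)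
    (hU : Z * cosh τ - Y * sinh τ ≤ 0) : 0 ≤ Y := by
  by_contra hn
  push Not at hn
  nlinarith [mul_pos (neg_pos.2 hn) (sinh_pos_iff.2 hτ), mul_nonneg hZ (cosh_pos τ).le]

/-- In `SwingStep.position` only the term with `Y` is harmful; by `κ_sq` its coefficient is `κ ^ 2 *
(S - s₀)`. The norm and the tilt bound give `Y ^ 2 ≤ E ^ 2 * S / s₀ + Z ^ 2`, hence `Y ≤ E * k + Z`.
The part with `Z` is absorbed by the first term, the part with `E` by the tilt term. -/
theorem Good.swing_up {c q₀ q κ ν Z Y E Z' Y' E' : ℝ} (hg : Good (sinh (2 * c)) q₀ ν Z Y E)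
    (hq : 0 < q) (hqq : q ≤ q₀) (hqc : q₀ < c) (hk : sinh (2 * c) < 3 * sinh (2 * q₀))
    (hκ : 0 < κ) (hκ2 : κ ^ 2 * sinh (2 * c) = sinh (2 * q))
    (h : SwingStep (q₀ - q) (q₀ + q) κ Z Y E Z' Y' E') : 0 < Z' := by
  have hpos := h.position
  rw [show q₀ + q - (q₀ - q) = 2 * q by ring, show q₀ - q + (q₀ + q) = 2 * q₀ by ring] at hpos
  obtain ⟨hE, hb, hn, hZ⟩ := hg
  set S := sinh (2 * c)
  set s₀ := sinh (2 * q₀)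
  set s := sinh (2 * q)
  set r := sinh (q₀ + q)
  have hs : 0 < s := sinh_pos_iff.2 (by linarith)
  have hs0 : 0 < s₀ := sinh_pos_iff.2 (by linarith)
  have hr : 0 < r := sinh_pos_iff.2 (by linarith)
  have hSs : s₀ < S := sinh_lt_sinh.2 (by linarith)
  have hrr : s₀ * s ≤ r ^ 2 := sinh_mul_sinh_le q₀ q
  have hS : 0 < S := hs0.trans hSs
  -- the bound on `Y`
  set k := √(S / s₀) with hkdef
  have hk0 : 0 < k := sqrt_pos.2 (by positivity)
  have hk2 : k ^ 2 * s₀ = S := by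
    rw [hkdef, sq_sqrt (by positivity)]; field_simp
  have hYb : Y ≤ E * k + Z := by
    apply le_of_sq_le_sq _ (by positivity)
    have : s₀ * Y ^ 2 ≤ s₀ * (E * k + Z) ^ 2 := by
      have e1 : s₀ * (E * k + Z) ^ 2 = E ^ 2 * S + 2 * s₀ * E * k * Z + s₀ * Z ^ 2 := by
        rw [← hk2]; ring
      have : 0 ≤ 2 * s₀ * E * k * Z := by positivity
      rw [e1]
      nlinarith
    exact le_of_mul_le_mul_left this hs0
  have hG : 0 < S - s₀ := by linarith
  -- After squaring and multiplying by `S * s₀`, this follows from `S - s₀ < 2 * s₀`, the only use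
  -- of the factor `3`, and from `s₀ * s ≤ r ^ 2`.
  have hlt : κ * (S - s₀) * k < 2 * r := by
    apply lt_of_pow_lt_pow_left₀ 2 (by positivity)
    have e2 : S * s₀ * (κ * (S - s₀) * k) ^ 2 = S * s * (S - s₀) ^ 2 := by
      rw [← hκ2]
      calc _ = S * (κ ^ 2) * (S - s₀) ^ 2 * (k ^ 2 * s₀) := by ring
        _ = _ := by rw [hk2]; ring
    have e3 : (S - s₀) ^ 2 < 4 * s₀ ^ 2 := by nlinarith
    have e4 : S * s₀ * (κ * (S - s₀) * k) ^ 2 < S * s₀ * (2 * r) ^ 2 := by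
      rw [e2]
      calc S * s * (S - s₀) ^ 2 < S * s * (4 * s₀ ^ 2) := by gcongr
        _ = S * s₀ * (4 * (s₀ * s)) := by ring
        _ ≤ S * s₀ * (4 * r ^ 2) := by gcongr
        _ = _ := by ring
    exact lt_of_mul_lt_mul_left e4 (by positivity)
  have hc1 : s ≤ cosh (2 * q) := (sinh_lt_cosh _).le
  have hZ' : 0 < (1 + κ ^ 2) * Z' := by
    rw [hpos]
    have f1 : s - κ ^ 2 * s₀ = κ ^ 2 * (S - s₀) := by rw [← hκ2]; ring
    rw [f1]
    have f2 : Y * (κ ^ 2 * (S - s₀)) ≤ (E * k + Z) * (κ ^ 2 * (S - s₀)) := by gcongr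
    have f3 : Z * (κ ^ 2 * (S - s₀)) ≤ Z * (cosh (2 * q) + κ ^ 2 * cosh (2 * q₀)) := by
      apply mul_le_mul_of_nonneg_left _ hZ
      have := mul_nonneg (sq_nonneg κ) hs0.le
      have := mul_nonneg (sq_nonneg κ) (cosh_pos (2 * q₀)).le
      nlinarith
    have f4 : κ * E * (κ * (S - s₀) * k) < κ * E * (2 * r) := by gcongr
    nlinarith
  exact pos_of_mul_pos_right hZ' (by positivity)

/-- Now the centre is farther from the frame before the turn than after it, and with `0 ≤ Y` every
term of `SwingStep.position` is nonnegative. -/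
theorem Good.swing_down {c q₀ q κ ν Z Y E Z' Y' E' : ℝ} (hg : Good (sinh (2 * c)) q₀ ν Z Y E)
    (hq : 0 < q) (hqq : q ≤ q₀) (hκ : 0 < κ) (hY : 0 ≤ Y)
    (h : SwingStep (q₀ + q) (q₀ - q) κ Z Y E Z' Y' E') : 0 ≤ Z' := by
  have hpos := h.position
  rw [show q₀ - q - (q₀ + q) = -(2 * q) by ring, show q₀ + q + (q₀ - q) = 2 * q₀ by ring,
    cosh_neg, sinh_neg] at hpos
  have hE := hg.tilt_pos
  have hZ := hg.position
  have hs : 0 < sinh (2 * q) := sinh_pos_iff.2 (by linarith)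
  have hs0 : 0 < sinh (2 * q₀) := sinh_pos_iff.2 (by linarith)
  have hr : 0 ≤ sinh (q₀ - q) := sinh_nonneg_iff.2 (by linarith)
  have := cosh_pos (2 * q)
  have := cosh_pos (2 * q₀)
  have hZ' : 0 ≤ (1 + κ ^ 2) * Z' := by
    rw [hpos, show Z * (cosh (2 * q) + κ ^ 2 * cosh (2 * q₀))
      - Y * (-sinh (2 * q) - κ ^ 2 * sinh (2 * q₀)) + 2 * κ * E * sinh (q₀ - q)
      = Z * (cosh (2 * q) + κ ^ 2 * cosh (2 * q₀))
      + Y * (sinh (2 * q) + κ ^ 2 * sinh (2 * q₀)) + 2 * κ * E * sinh (q₀ - q) by ring]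
    positivity
  exact nonneg_of_mul_nonneg_right hZ' (by positivity)

/-- The distance from the centre of step `j` to the frame before (`ε = 1`) or after (`ε = -1`)
the step. -/
noncomputable def arm (q₀ q : ℝ) (j : ℕ) : ℝ := if Even j then q₀ - q else q₀ + q

/-- A sweep: a sequence of positions of the moving line. -/
structure Sweep (c q₀ ν : ℝ) (J : ℕ) (q κ Z Y E : ℕ → ℝ) : Prop where
  even : Even J
  q₀_lt : q₀ < c
  lt_q₀ : sinh (2 * c) < 3 * sinh (2 * q₀)
  q_pos : ∀ j < J, 0 < q j
  q_le : ∀ j < J, q j ≤ q₀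
  κ_pos : ∀ j < J, 0 < κ j
  κ_sq : ∀ j < J, κ j ^ 2 * sinh (2 * c) = sinh (2 * q j)
  norm : ∀ j ≤ J, Y j ^ 2 + E j ^ 2 - Z j ^ 2 = ν
  step : ∀ j < J, SwingStep (arm q₀ (q j) j) (arm q₀ (q j) (j + 1)) (κ j)
    (Z j) (Y j) (E j) (Z (j + 1)) (Y (j + 1)) (E (j + 1))

theorem Sweep.reverse {c q₀ ν : ℝ} {J : ℕ} {q κ Z Y E : ℕ → ℝ} (h : Sweep c q₀ ν J q κ Z Y E) :
    Sweep c q₀ ν J (fun j => q (J - 1 - j)) (fun j => κ (J - 1 - j)) (fun j => -Z (J - j))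
      (fun j => -Y (J - j)) (fun j => E (J - j)) := by
  refine ⟨h.even, h.q₀_lt, h.lt_q₀, fun j hj => h.q_pos _ (by omega),
    fun j hj => h.q_le _ (by omega), fun j hj => h.κ_pos _ (by omega),
    fun j hj => h.κ_sq _ (by omega), fun j hj => ?_, fun j hj => ?_⟩
  · simpa using h.norm (J - j) (by omega)
  · have h1 := (h.step (J - 1 - j) (by omega)).reverse
    have e1 : J - 1 - j + 1 = J - j := by omega
    have e2 : J - (j + 1) = J - 1 - j := by omega
    have p1 : Even (J - j) ↔ Even j := by
      have := h.even
      rw [Nat.even_sub (by omega)]; tauto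
    have p2 : Even (J - 1 - j) ↔ Even (j + 1) := by
      rw [← e2, Nat.even_sub (by omega)]; have := h.even; tauto
    rw [e1] at h1
    simp only [arm, p1, p2] at h1 ⊢
    simpa only [e2] using h1

/-- The tilt bound survives because `E` does not decrease. Odd positions come from `Good.swing_up`,
which is strict; this strictness decides `Sweep.false`. -/
theorem Sweep.good {c q₀ ν : ℝ} {J : ℕ} {q κ Z Y E : ℕ → ℝ} (h : Sweep c q₀ ν J q κ Z Y E)
    (h0 : Z 0 * cosh (c - q₀) - Y 0 * sinh (c - q₀) ≤ 0 →
      Good (sinh (2 * c)) q₀ ν (Z 0) (Y 0) (E 0)) (j : ℕ) (hj : j ≤ J)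
    (hU : ∀ i ≤ j, Z i * cosh (c - q₀) - Y i * sinh (c - q₀) ≤ 0) :
    Good (sinh (2 * c)) q₀ ν (Z j) (Y j) (E j) ∧ 0 ≤ Y j ∧ (¬ Even j → 0 < Z j) := by
  have hτ : 0 < c - q₀ := by linarith [h.q₀_lt]
  induction j with
  | zero =>
    have hg := h0 (hU 0 le_rfl)
    exact ⟨hg, nonneg_of_upper_nonpos hτ hg.position (hU 0 le_rfl), by simp⟩
  | succ j ih =>
    obtain ⟨hg, hY, hZ⟩ := ih (by omega) (fun i hi => hU i (by omega))
    have hst := h.step j hj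
    have hq := h.q_pos j hj
    have hqq := h.q_le j hj
    have hκ := h.κ_pos j hj
    have hZ' : 0 ≤ Z (j + 1) ∧ (¬ Even (j + 1) → 0 < Z (j + 1)) := by
      by_cases hev : Even j
      · have hodd : ¬ Even (j + 1) := by simpa [Nat.even_add_one] using hev
        have h2 := hst
        simp only [arm, hev, hodd, if_true, if_false] at h2
        have := hg.swing_up hq hqq h.q₀_lt h.lt_q₀ hκ (h.κ_sq j hj) h2
        exact ⟨this.le, fun _ => this⟩
      · have hodd : Even (j + 1) := by simpa [Nat.even_add_one] using hev
        have h2 := hst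
        simp only [arm, hev, hodd, if_true, if_false] at h2
        exact ⟨hg.swing_down hq hqq hκ hY h2, fun hn => absurd hodd hn⟩
    have harm : ∀ i, 0 ≤ arm q₀ (q j) i := by
      intro i; unfold arm; split_ifs <;> linarith
    have hE := hst.tilt_mono (harm _) (harm _) hτ hκ hg.position hY hg.tilt_pos
      (hU (j + 1) le_rfl)
    have hs : 0 < sinh (2 * c) + sinh (2 * q₀) := by
      have h1 : 0 < sinh (2 * q₀) := sinh_pos_iff.2 (by linarith)
      have h2 : 0 < sinh (2 * c) := sinh_pos_iff.2 (by linarith)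
      linarith
    refine ⟨⟨hg.tilt_pos.trans_le hE, hg.tilt_bound.trans ?_, h.norm _ hj, hZ'.1⟩,
      nonneg_of_upper_nonpos hτ hZ'.1 (hU (j + 1) le_rfl), hZ'.2⟩
    have := hg.tilt_pos
    gcongr

/-- A sweep cannot turn from one side of the fixed line to the other one. -/
theorem Sweep.false {c q₀ ν : ℝ} {J : ℕ} {q κ Z Y E : ℕ → ℝ} (h : Sweep c q₀ ν J q κ Z Y E)
    (hq₀ : 0 < q₀)
    (hL0 : 0 < Z 0 * cosh (c + q₀) + Y 0 * sinh (c + q₀))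
    (hLJ : Z J * cosh (c + q₀) + Y J * sinh (c + q₀) < 0)
    (h0 : Z 0 * cosh (c - q₀) - Y 0 * sinh (c - q₀) ≤ 0 →
      Good (sinh (2 * c)) q₀ ν (Z 0) (Y 0) (E 0))
    (hJ : 0 ≤ Z J * cosh (c - q₀) - Y J * sinh (c - q₀) →
      Good (sinh (2 * c)) q₀ ν (-Z J) (-Y J) (E J))
    (hmono : ∀ j < J, 0 < Z j * cosh (c - q₀) - Y j * sinh (c - q₀) →
      0 < Z (j + 1) * cosh (c - q₀) - Y (j + 1) * sinh (c - q₀)) : False := by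
  have hc := h.q₀_lt
  have hc1 : 0 < cosh (c + q₀) := cosh_pos _
  have hs1 : 0 < sinh (c + q₀) := sinh_pos_iff.2 (by linarith)
  have hc2 : 0 < cosh (c - q₀) := cosh_pos _
  have hs2 : 0 < sinh (c - q₀) := sinh_pos_iff.2 (by linarith)
  have hr := h.reverse
  have hr0 : -Z (J - 0) * cosh (c - q₀) - -Y (J - 0) * sinh (c - q₀) ≤ 0 →
      Good (sinh (2 * c)) q₀ ν (-Z (J - 0)) (-Y (J - 0)) (E (J - 0)) := by
    intro hU
    rw [Nat.sub_zero] at hU ⊢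
    exact hJ (by linarith)
  set U : ℕ → ℝ := fun j => Z j * cosh (c - q₀) - Y j * sinh (c - q₀) with hUdef
  have hup : ∀ i j, i ≤ j → j ≤ J → 0 < U i → 0 < U j := by
    intro i j hij
    induction j, hij using Nat.le_induction with
    | base => exact fun _ h => h
    | succ j hij ih => exact fun hjJ hi => hmono j (by omega) (ih (by omega) hi)
  have hleft : ∀ k ≤ J, (∀ i, k ≤ i → i ≤ J → 0 < U i) →
      0 ≤ -Z k ∧ 0 ≤ -Y k ∧ (¬ Even k → 0 < -Z k) := by
    intro k hk hpos
    have := hr.good hr0 (J - k) (by omega) (fun i hi => by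
      have := hpos (J - i) (by omega) (by omega)
      simp only [hUdef] at this
      linarith)
    rw [show J - (J - k) = k by omega] at this
    refine ⟨this.1.position, this.2.1, fun hodd => this.2.2 ?_⟩
    have hJe := h.even
    rw [Nat.even_sub hk]; tauto
  -- At the first index with a positive upper end the forward run stops and the backward run takes
  -- over. If this index is `0` or does not exist, one run covers the whole sweep and contradicts
  -- the sign of a lower end.
  by_cases hex : ∃ k ≤ J, 0 < U k
  · classical
    set k := Nat.find hex with hk
    obtain ⟨hkJ, hUk⟩ := Nat.find_spec hex
    rw [← hk] at hkJ hUk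
    have hmin : ∀ i < k, U i ≤ 0 := by
      intro i hi
      have := Nat.find_min hex hi
      by_contra hcon
      exact this ⟨by omega, by linarith⟩
    obtain ⟨l1, l2, l3⟩ := hleft k hkJ (fun i hi hiJ => hup k i hi hiJ hUk)
    rcases Nat.eq_zero_or_pos k with hk0 | hkpos
    · rw [hk0] at l1 l2
      nlinarith [mul_nonneg l1 hc1.le, mul_nonneg l2 hs1.le]
    · obtain ⟨m, hm⟩ : ∃ m, k = m + 1 := ⟨k - 1, by omega⟩
      rw [hm] at l1 l2 l3 hkJ
      have hmJ : m < J := by omega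
      obtain ⟨g, r2, r3⟩ := h.good h0 m hmJ.le (fun i hi => hmin i (by omega))
      have r1 := g.position
      have hcen := (h.step m hmJ).center
      have harm : ∀ i, 0 ≤ arm q₀ (q m) i := by
        have := h.q_le m hmJ
        have := h.q_pos m hmJ
        intro i; unfold arm; split_ifs <;> linarith
      have a1 := sinh_nonneg_iff.2 (harm m)
      have a2 := sinh_nonneg_iff.2 (harm (m + 1))
      have b1 := cosh_pos (arm q₀ (q m) m)
      have b2 := cosh_pos (arm q₀ (q m) (m + 1))
      -- One of `m`, `m + 1` is odd, and there the position has a strict sign; so the two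
      -- expressions for the value at the centre cannot agree.
      by_cases hev : Even m
      · have := l3 (by simpa [Nat.even_add_one] using hev)
        nlinarith [mul_nonneg r1 b1.le, mul_nonneg r2 a1, mul_pos this b2, mul_nonneg l2 a2]
      · have := r3 hev
        nlinarith [mul_nonneg l1 b2.le, mul_nonneg r2 a1, mul_pos this b1, mul_nonneg l2 a2]
  · push Not at hex
    obtain ⟨g, r2, -⟩ := h.good h0 J le_rfl (fun i hi => hex i hi)
    nlinarith [mul_nonneg g.position hc1.le, mul_nonneg r2 hs1.le]

/-! ### Minkowski algebra -/

/-- The Minkowski form of signature `(2, 1)`. -/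
def mink (p q : ℝ × ℝ × ℝ) : ℝ := p.1 * q.1 + p.2.1 * q.2.1 - p.2.2 * q.2.2

/-- The determinant of three vectors. -/
def vdet (p q r : ℝ × ℝ × ℝ) : ℝ :=
  p.1 * (q.2.1 * r.2.2 - q.2.2 * r.2.1) - p.2.1 * (q.1 * r.2.2 - q.2.2 * r.1)
    + p.2.2 * (q.1 * r.2.1 - q.2.1 * r.1)

theorem mink_comm (p q : ℝ × ℝ × ℝ) : mink p q = mink q p := by unfold mink; ring

@[simp] theorem mink_add_left (p q r : ℝ × ℝ × ℝ) : mink (p + q) r = mink p r + mink q r := by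
  simp [mink]; ring

@[simp] theorem mink_sub_left (p q r : ℝ × ℝ × ℝ) : mink (p - q) r = mink p r - mink q r := by
  simp [mink]; ring

@[simp] theorem mink_smul_left (a : ℝ) (p r : ℝ × ℝ × ℝ) : mink (a • p) r = a * mink p r := by
  simp [mink]; ring

@[simp] theorem mink_add_right (p q r : ℝ × ℝ × ℝ) : mink p (q + r) = mink p q + mink p r := by
  simp [mink]; ring

@[simp] theorem mink_sub_right (p q r : ℝ × ℝ × ℝ) : mink p (q - r) = mink p q - mink p r := by
  simp [mink]; ring

@[simp] theorem mink_smul_right (a : ℝ) (p r : ℝ × ℝ × ℝ) : mink p (a • r) = a * mink p r := by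
  simp [mink]; ring

/-- The Gram determinant; the sign is the determinant of the form. -/
theorem vdet_mul_vdet (a b c a' b' c' : ℝ × ℝ × ℝ) :
    vdet a b c * vdet a' b' c' =
      -(mink a a' * (mink b b' * mink c c' - mink b c' * mink c b')
        - mink a b' * (mink b a' * mink c c' - mink b c' * mink c a')
        + mink a c' * (mink b a' * mink c b' - mink b b' * mink c a')) := by
  simp only [vdet, mink]; ring

theorem vdet_rotate (a b c : ℝ × ℝ × ℝ) : vdet a b c = vdet b c a := by
  simp only [vdet]; ring

theorem vdet_swap (a b c : ℝ × ℝ × ℝ) : vdet a b c = -vdet a c b := by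
  simp only [vdet]; ring

@[simp] theorem vdet_sub_left (a b c d : ℝ × ℝ × ℝ) :
    vdet (a - b) c d = vdet a c d - vdet b c d := by
  simp [vdet]; ring

@[simp] theorem vdet_smul_left (r : ℝ) (a c d : ℝ × ℝ × ℝ) :
    vdet (r • a) c d = r * vdet a c d := by
  simp [vdet]; ring

theorem vdet_combination (x v t : ℝ × ℝ × ℝ) (a b c d : ℝ) :
    vdet x (a • v + b • t) (c • v + d • t) = (a * d - b * c) * vdet x v t := by
  simp [vdet]; ring

/-- Cramer's rule for four vectors. -/
theorem vdet_cramer (v t w s : ℝ × ℝ × ℝ) :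
    vdet s t w • v + vdet v s w • t = vdet v t w • s + vdet v s t • w := by
  ext <;> simp [vdet] <;> ring

/-! ### The crossing of two successive altitudes -/

/-- Two crossing segments with the metric data of two altitudes cross symmetrically. -/
theorem crossing_symmetric {v t w s : ℝ × ℝ × ℝ} {A₁ B₁ A₂ B₂ C X : ℝ}
    (hB₁ : 0 < B₁) (hB₂ : 0 < B₂) (hC : 1 < C) (hX : 1 < X)
    (hrel : A₁ • v + B₁ • t = A₂ • w + B₂ • s)
    (hvv : mink v v = -1) (htt : mink t t = -1) (hww : mink w w = -1) (hss : mink s s = -1)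
    (hvt : mink v t = -C) (hws : mink w s = -C) (hvw : mink v w = -(C * X))
    (htw : mink t w = -X) (hvs : mink v s = -X) :
    A₁ = A₂ ∧ B₁ = B₂ ∧ A₁ * (C * X - 1) = B₁ * (C - X) := by
  have htv : mink t v = -C := by rw [mink_comm, hvt]
  have hsw : mink s w = -C := by rw [mink_comm, hws]
  have hwv : mink w v = -(C * X) := by rw [mink_comm, hvw]
  have hsv : mink s v = -X := by rw [mink_comm, hvs]
  have e1 := congrArg (fun z => mink z v) hrel
  have e2 := congrArg (fun z => mink z w) hrel
  have e3 := congrArg (fun z => mink z z) hrel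
  simp only [mink_add_left, mink_smul_left, mink_add_right, mink_smul_right, hvv, htt, hww, hss,
    hvt, hws, hvw, htw, htv, hsw, hwv, hsv] at e1 e2 e3
  have f1 : (A₁ + A₂) * (C * X - 1) = (B₁ + B₂) * (C - X) := by linear_combination e1 - e2
  have f2 : (A₁ - A₂) * (1 + C * X) = -(B₁ - B₂) * (C + X) := by linear_combination -e1 - e2
  have f3 : (A₁ - A₂) * (A₁ + A₂ + C * (B₁ + B₂)) +
      (B₁ - B₂) * (B₁ + B₂ + C * (A₁ + A₂)) = 0 := by linear_combination -e3
  have hCX : 1 < C * X := by nlinarith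
  have hBs : 0 < B₁ + B₂ := by linarith
  -- Eliminate `A₁ - A₂` from `f3` by `f2`, then `A₁ + A₂` by `f1`.
  have hB : (B₁ - B₂) * ((B₁ + B₂) * ((C ^ 2 - 1) * (X ^ 2 - 1))) = 0 := by
    linear_combination (-(1 + C * X) * (C * X - 1)) * f3
      + ((C * X - 1) * (A₁ + A₂ + C * (B₁ + B₂))) * f2
      + (B₁ - B₂) * (C * (1 + C * X) - (C + X)) * f1
  have hne : (B₁ + B₂) * ((C ^ 2 - 1) * (X ^ 2 - 1)) ≠ 0 := by
    have h1 : 0 < C ^ 2 - 1 := by nlinarith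
    have h2 : 0 < X ^ 2 - 1 := by nlinarith
    positivity
  have hB' : B₁ = B₂ := by
    rcases mul_eq_zero.1 hB with h | h
    · linarith
    · exact absurd h hne
  have hA' : A₁ = A₂ := by
    rw [hB', sub_self, neg_zero, zero_mul] at f2
    rcases mul_eq_zero.1 f2 with h | h
    · linarith
    · nlinarith
  refine ⟨hA', hB', ?_⟩
  rw [← hA', ← hB'] at f1
  linarith

/-- Since `C - X < C * X - 1`, symmetry gives `A₁ < B₁`: the crossing point is nearer to the foot
than to the vertex. The intermediate value theorem then finds its distance `q` from the midpoint. -/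
theorem exists_crossing {v t w s : ℝ × ℝ × ℝ} {A₁ B₁ A₂ B₂ c X : ℝ} (hc : 0 < c)
    (hA₁ : 0 < A₁) (hB₁ : 0 < B₁) (hB₂ : 0 < B₂) (hX : 1 < X)
    (hrel : A₁ • v + B₁ • t = A₂ • w + B₂ • s)
    (hvv : mink v v = -1) (htt : mink t t = -1) (hww : mink w w = -1) (hss : mink s s = -1)
    (hvt : mink v t = -cosh (2 * c)) (hws : mink w s = -cosh (2 * c))
    (hvw : mink v w = -(cosh (2 * c) * X)) (htw : mink t w = -X) (hvs : mink v s = -X) :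
    ∃ q, 0 < q ∧ q < c ∧ X * cosh (c - q) = cosh (c + q) ∧
      sinh (c - q) • v + sinh (c + q) • t = sinh (c - q) • w + sinh (c + q) • s := by
  have hC : 1 < cosh (2 * c) := one_lt_cosh.2 (by positivity)
  obtain ⟨hA, hB, hAB⟩ := crossing_symmetric hB₁ hB₂ hC hX hrel hvv htt hww hss hvt hws
    hvw htw hvs
  rw [← hA, ← hB] at hrel
  set C := cosh (2 * c) with hCdef
  have hlt : A₁ < B₁ := by
    have h1 : 0 < C * X - 1 := by nlinarith
    have h2 : 0 < C - X := pos_of_mul_pos_right (hAB ▸ mul_pos hA₁ h1) hB₁.le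
    have h3 : C - X < C * X - 1 := by nlinarith
    by_contra hn
    push Not at hn
    have h4 : B₁ * (C - X) ≤ A₁ * (C - X) := by gcongr
    have h5 : A₁ * (C - X) < A₁ * (C * X - 1) := by gcongr
    linarith
  have hcont : ContinuousOn (fun q => A₁ * sinh (c + q) - B₁ * sinh (c - q)) (Set.Icc 0 c) := by
    fun_prop
  have hs := sinh_pos_iff.2 hc
  obtain ⟨q, ⟨hq0, hqc⟩, hq⟩ := intermediate_value_Ioo hc.le hcont
    (show (0 : ℝ) ∈ _ by
      simp only [add_zero, sub_zero, sub_self, sinh_zero, mul_zero, Set.mem_Ioo]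
      exact ⟨by nlinarith, mul_pos hA₁ (sinh_pos_iff.2 (by linarith))⟩)
  simp only at hq
  have ha : 0 < sinh (c - q) := sinh_pos_iff.2 (by linarith)
  have hS : 0 < sinh (2 * c) := sinh_pos_iff.2 (by linarith)
  have hsum : 2 * c = (c - q) + (c + q) := by ring
  refine ⟨q, hq0, hqc, ?_, ?_⟩
  · have hC2 : C = cosh (c - q) * cosh (c + q) + sinh (c - q) * sinh (c + q) := by
      rw [hCdef, hsum, cosh_add]
    have hS2 : sinh (2 * c) = sinh (c - q) * cosh (c + q) + cosh (c - q) * sinh (c + q) := by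
      rw [hsum, sinh_add]
    have h6 : A₁ * (sinh (c - q) * (C * X - 1)) = A₁ * (sinh (c + q) * (C - X)) := by
      linear_combination sinh (c - q) * hAB - (C - X) * hq
    have h7 := mul_left_cancel₀ hA₁.ne' h6
    have k1 := cosh_sq (c - q)
    have k2 := cosh_sq (c + q)
    apply mul_left_cancel₀ hS.ne'
    rw [hS2]
    rw [hC2] at h7
    linear_combination h7 + (X * sinh (c + q)) * k1 - sinh (c - q) * k2
  · have h8 : A₁ • (sinh (c - q) • v + sinh (c + q) • t)
        = A₁ • (sinh (c - q) • w + sinh (c + q) • s) := by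
      have h9 : A₁ * sinh (c + q) = sinh (c - q) * B₁ := by linarith
      rw [smul_add, smul_add, smul_smul, smul_smul, smul_smul, smul_smul, h9,
        mul_comm A₁, ← smul_smul, ← smul_smul, ← smul_smul, ← smul_smul, ← smul_add, ← smul_add,
        hrel]
    exact smul_right_injective _ hA₁.ne' h8

/-- With `o` the crossing point, `d` is the unit tangent from `v` to `t` and `d'` the one from `s`
to `w`, so the vertex and the foot change roles. In the right triangle `o t w` the cosine of the
angle is `tanh a / tanh b`, and the half-angle formula gives `κ ^ 2 = sinh (b - a) / sinh (a + b)`.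
-/
theorem crossing_rotation {v t w s : ℝ × ℝ × ℝ} {a b X : ℝ} (ha : 0 < a) (hab : a < b)
    (hX : X * cosh a = cosh b)
    (hrel : sinh a • v + sinh b • t = sinh a • w + sinh b • s)
    (hvv : mink v v = -1) (htt : mink t t = -1) (hww : mink w w = -1) (hss : mink s s = -1)
    (hvt : mink v t = -cosh (a + b)) (hws : mink w s = -cosh (a + b))
    (hvw : mink v w = -(cosh (a + b) * X)) (htw : mink t w = -X)
    (hpos : 0 < vdet v t w) :
    ∃ κ, 0 < κ ∧ κ ^ 2 * sinh (a + b) = sinh (b - a) ∧ ∀ N,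
      (1 + κ ^ 2) * (cosh a * mink N w - cosh b * mink N s) =
        (1 - κ ^ 2) * (cosh b * mink N t - cosh a * mink N v) + 2 * κ * vdet N v t ∧
      (1 + κ ^ 2) * vdet N s w =
        (1 - κ ^ 2) * vdet N v t - 2 * κ * (cosh b * mink N t - cosh a * mink N v) := by
  have hS : 0 < sinh (a + b) := sinh_pos_iff.2 (by linarith)
  have hD : 0 < sinh (b - a) := sinh_pos_iff.2 (by linarith)
  have hsa : 0 < sinh a := sinh_pos_iff.2 ha
  have hsb : 0 < sinh b := sinh_pos_iff.2 (by linarith)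
  have hca := cosh_pos a
  have hcb := cosh_pos b
  have k1 := cosh_sq a
  have k2 := cosh_sq b
  have hSe := sinh_add a b
  have hCe := cosh_add a b
  have hDe := sinh_sub b a
  set S := sinh (a + b)
  set C := cosh (a + b)
  set sa := sinh a
  set sb := sinh b
  set ca := cosh a
  set cb := cosh b
  have htv : mink t v = -C := by rw [mink_comm, hvt]
  have hsw : mink s w = -C := by rw [mink_comm, hws]
  have hwv : mink w v = -(C * X) := by rw [mink_comm, hvw]
  have hwt : mink w t = -X := by rw [mink_comm, htw]
  -- the frame at the crossing point
  set o : ℝ × ℝ × ℝ := S⁻¹ • (sa • v + sb • t) with ho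
  have ho' : o = S⁻¹ • (sa • w + sb • s) := by rw [ho, hrel]
  set d : ℝ × ℝ × ℝ := S⁻¹ • ((-ca) • v + cb • t) with hd
  set d' : ℝ × ℝ × ℝ := S⁻¹ • (ca • w + (-cb) • s) with hd'
  have hoo : mink o o = -1 := by
    simp only [ho, mink_add_left, mink_smul_left, mink_add_right, mink_smul_right, hvv, htt, hvt,
      htv]
    field_simp
    rw [hSe, hCe]
    linear_combination sb ^ 2 * k1 + sa ^ 2 * k2
  have hod : mink o d = 0 := by
    simp only [ho, hd, mink_add_left, mink_smul_left, mink_add_right, mink_smul_right, hvv, htt,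
      hvt, htv]
    field_simp
    rw [hCe]
    linear_combination (cb * sb) * k1 - ca * sa * k2
  have hdd : mink d d = 1 := by
    simp only [hd, mink_add_left, mink_smul_left, mink_add_right, mink_smul_right, hvv, htt,
      hvt, htv]
    field_simp
    rw [hCe, hSe]
    linear_combination cb ^ 2 * k1 + ca ^ 2 * k2
  have hod' : mink o d' = 0 := by
    simp only [ho', hd', mink_add_left, mink_smul_left, mink_add_right, mink_smul_right, hww, hss,
      hws, hsw]
    field_simp
    rw [hCe]
    linear_combination -(cb * sb) * k1 + ca * sa * k2
  have hdd' : mink d' d' = 1 := by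
    simp only [hd', mink_add_left, mink_smul_left, mink_add_right, mink_smul_right, hww, hss,
      hws, hsw]
    field_simp
    rw [hCe, hSe]
    linear_combination cb ^ 2 * k1 + ca ^ 2 * k2
  have hsbd : sb • d' = w - cb • o := by
    rw [ho', hd', smul_smul, smul_smul, smul_add, smul_add, smul_smul, smul_smul, smul_smul,
      smul_smul]
    have e1 : sb * S⁻¹ * ca = 1 - cb * S⁻¹ * sa := by
      field_simp; rw [hSe]; ring
    rw [e1]
    module
  have hcω : ca * (sb * mink d d') = sa * cb := by
    have e1 : sb * mink d d' = mink d (sb • d') := by simp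
    have hdo : mink d o = 0 := by rw [mink_comm, hod]
    rw [e1, hsbd, mink_sub_right, mink_smul_right, hdo]
    simp only [hd, mink_add_left, mink_smul_left, hvw, htw]
    field_simp
    rw [hCe, hSe]
    linear_combination ca * X * cb * k1 + sa * (sa * cb + ca * sb) * hX
  set κ := √(sinh (b - a) / S) with hκ
  have hκ0 : 0 < κ := sqrt_pos.2 (by positivity)
  have hκ2 : κ ^ 2 * S = sinh (b - a) := by
    rw [hκ, sq_sqrt (by positivity)]; field_simp
  have hp : (1 + κ ^ 2) * S = 2 * sb * ca := by
    linear_combination hκ2 + hSe + hDe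
  have hm : (1 - κ ^ 2) * S = 2 * sa * cb := by
    linear_combination -hκ2 + hSe - hDe
  have hω : (1 + κ ^ 2) * mink d d' = 1 - κ ^ 2 := by
    apply mul_right_cancel₀ hS.ne'
    linear_combination mink d d' * hp + 2 * hcω - hm
  have hdo : mink d o = 0 := by rw [mink_comm, hod]
  have hd'o : mink d' o = 0 := by rw [mink_comm, hod']
  have hd'd : mink d' d = mink d d' := mink_comm _ _
  have hNod : ∀ N, vdet N o d = S⁻¹ * vdet N v t := by
    intro N
    rw [ho, hd, smul_add, smul_add, smul_smul, smul_smul, smul_smul, smul_smul, vdet_combination]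
    field_simp
    rw [hSe]; ring
  have hNod' : ∀ N, vdet N o d' = S⁻¹ * vdet N s w := by
    intro N
    rw [ho', hd', smul_add, smul_add, smul_smul, smul_smul, smul_smul, smul_smul,
      vdet_combination, vdet_swap N s w]
    field_simp
    rw [hSe]; ring
  -- The orientation selects the sign of the sine.
  have hs0 : 0 < vdet d' o d := by
    have e1 : sb * vdet d' o d = S⁻¹ * vdet v t w := by
      rw [← vdet_smul_left, hsbd, vdet_sub_left, vdet_smul_left, hNod w, vdet_rotate v t w,
        vdet_rotate t w v]
      have : vdet o o d = 0 := by simp only [vdet]; ring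
      rw [this]; ring
    exact pos_of_mul_pos_right (e1 ▸ mul_pos (inv_pos.2 hS) hpos) hsb.le
  have hs2 : vdet d' o d ^ 2 = 1 - mink d d' ^ 2 := by
    rw [sq, vdet_mul_vdet, hdd', hoo, hdd, hod, hdo, hod', hd'o, hd'd]; ring
  have hs : (1 + κ ^ 2) * vdet d' o d = 2 * κ := by
    have : ((1 + κ ^ 2) * vdet d' o d) ^ 2 = (2 * κ) ^ 2 := by
      rw [mul_pow, hs2]
      linear_combination -((1 + κ ^ 2) * mink d d' + (1 - κ ^ 2)) * hω
    exact (sq_eq_sq₀ (by positivity) (by positivity)).1 this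
  refine ⟨κ, hκ0, hκ2, fun N => ?_⟩
  have hND : S * mink N d = cosh b * mink N t - cosh a * mink N v := by
    rw [hd, mink_smul_right, mink_add_right, mink_smul_right, mink_smul_right]
    field_simp; ring
  have hND' : S * mink N d' = cosh a * mink N w - cosh b * mink N s := by
    rw [hd', mink_smul_right, mink_add_right, mink_smul_right, mink_smul_right]
    field_simp; ring
  have g1 : vdet N o d * vdet d' o d = mink N d' - mink N d * mink d d' := by
    rw [vdet_mul_vdet, hod', hoo, hod, hdo, hdd]
    ring
  have g2 : vdet N o d' * vdet d' o d = mink N d' * mink d d' - mink N d := by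
    rw [vdet_mul_vdet, hod', hoo, hod, hd'o, hdd', hd'd]
    ring
  rw [← hND, ← hND']
  have q1 : vdet N v t = S * vdet N o d := by rw [hNod]; field_simp
  have q2 : vdet N s w = S * vdet N o d' := by rw [hNod']; field_simp
  rw [q1, q2]
  constructor
  · linear_combination (-S * (1 + κ ^ 2)) * g1 + S * vdet N o d * hs + S * mink N d * hω
  · apply mul_right_cancel₀ hs0.ne'
    linear_combination S * (1 + κ ^ 2) * g2 - S * (1 - κ ^ 2) * g1 + S * mink N d' * hω
      - S * mink N d * vdet d' o d * hs + S * mink N d * (1 + κ ^ 2) * hs2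
      - S * mink N d * mink d d' * hω

/-! ### Coordinates of a functional along an altitude -/

/-- The position relative to the functional `⟨N, ·⟩` of the point at distance `c + q₀` from `l` on
the segment from `l` to `u` of length `2 * c`. -/
noncomputable def posZ (c q₀ : ℝ) (N l u : ℝ × ℝ × ℝ) : ℝ :=
  (sinh (c - q₀) * mink N l + sinh (c + q₀) * mink N u) / sinh (2 * c)

/-- The negative of the derivative at that point along the segment. -/
noncomputable def posY (c q₀ : ℝ) (N l u : ℝ × ℝ × ℝ) : ℝ :=
  (cosh (c - q₀) * mink N l - cosh (c + q₀) * mink N u) / sinh (2 * c)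

/-- The component of `N` in the direction normal to the segment. -/
noncomputable def posE (c : ℝ) (N l u : ℝ × ℝ × ℝ) : ℝ := vdet N l u / sinh (2 * c)

section position

variable {c q₀ : ℝ} (N l u : ℝ × ℝ × ℝ)

theorem pos_center (ρ : ℝ) : posZ c q₀ N l u * cosh ρ + posY c q₀ N l u * sinh ρ =
    (sinh (c - q₀ + ρ) * mink N l + sinh (c + q₀ - ρ) * mink N u) / sinh (2 * c) := by
  rw [posZ, posY, sinh_add (c - q₀) ρ, sinh_sub (c + q₀) ρ]; ring

theorem pos_slope (ρ : ℝ) : posZ c q₀ N l u * sinh ρ + posY c q₀ N l u * cosh ρ =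
    (cosh (c - q₀ + ρ) * mink N l - cosh (c + q₀ - ρ) * mink N u) / sinh (2 * c) := by
  rw [posZ, posY, cosh_add (c - q₀) ρ, cosh_sub (c + q₀) ρ]; ring

theorem pos_lower (hc : 0 < c) : posZ c q₀ N l u * cosh (c + q₀) + posY c q₀ N l u * sinh (c + q₀)
    = mink N l := by
  have hS : sinh (2 * c) ≠ 0 := (sinh_pos_iff.2 (by linarith)).ne'
  rw [pos_center, show c - q₀ + (c + q₀) = 2 * c by ring, sub_self, sinh_zero]
  field_simp; ring

theorem pos_upper (hc : 0 < c) : posZ c q₀ N l u * cosh (c - q₀) - posY c q₀ N l u * sinh (c - q₀)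
    = mink N u := by
  have hS : sinh (2 * c) ≠ 0 := (sinh_pos_iff.2 (by linarith)).ne'
  have h := pos_center (c := c) (q₀ := q₀) N l u (-(c - q₀))
  rw [show c - q₀ + -(c - q₀) = 0 by ring, show c + q₀ - -(c - q₀) = 2 * c by ring, sinh_zero,
    sinh_neg, cosh_neg] at h
  rw [sub_eq_add_neg, ← mul_neg, h]
  field_simp; ring

/-- The Minkowski square of `N` in the orthonormal frame of point, tangent and normal. -/
theorem pos_norm (hc : 0 < c) (hll : mink l l = -1) (huu : mink u u = -1)
    (hlu : mink l u = -cosh (2 * c)) :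
    posY c q₀ N l u ^ 2 + posE c N l u ^ 2 - posZ c q₀ N l u ^ 2 = mink N N := by
  have hS : sinh (2 * c) ≠ 0 := (sinh_pos_iff.2 (by linarith)).ne'
  have hul : mink u l = -cosh (2 * c) := by rw [mink_comm, hlu]
  have h1 := vdet_mul_vdet N l u N l u
  rw [hll, huu, hlu, hul, mink_comm l N, mink_comm u N] at h1
  have h2 : cosh (2 * c) = cosh (c - q₀) * cosh (c + q₀) + sinh (c - q₀) * sinh (c + q₀) := by
    rw [← cosh_add]; ring_nf
  have h3 := cosh_sq (2 * c)
  have k1 := cosh_sq (c - q₀)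
  have k2 := cosh_sq (c + q₀)
  rw [posY, posE, posZ]
  set S := sinh (2 * c)
  field_simp
  linear_combination h1 + mink N l ^ 2 * k1 + mink N u ^ 2 * k2 + 2 * mink N l * mink N u * h2
    + mink N N * h3

end position

/-- The two cases are those in which the lower end before the turn is the vertex or the foot. The
crossing point is at `c + q` or `c - q` from the lower end and the frame at `c + q₀`, hence the arms
`q₀ - q` and `q₀ + q`. -/
theorem swing_of_crossing {v t w s : ℝ × ℝ × ℝ} {c q κ : ℝ} (q₀ : ℝ) (N : ℝ × ℝ × ℝ)
    (hrel : sinh (c - q) • v + sinh (c + q) • t = sinh (c - q) • w + sinh (c + q) • s)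
    (h1 : (1 + κ ^ 2) * (cosh (c - q) * mink N w - cosh (c + q) * mink N s) =
        (1 - κ ^ 2) * (cosh (c + q) * mink N t - cosh (c - q) * mink N v) + 2 * κ * vdet N v t)
    (h2 : (1 + κ ^ 2) * vdet N s w =
        (1 - κ ^ 2) * vdet N v t - 2 * κ * (cosh (c + q) * mink N t - cosh (c - q) * mink N v)) :
    SwingStep (q₀ - q) (q₀ + q) κ (posZ c q₀ N v t) (posY c q₀ N v t) (posE c N v t)
      (posZ c q₀ N s w) (posY c q₀ N s w) (posE c N s w) ∧
    SwingStep (q₀ + q) (q₀ - q) κ (posZ c q₀ N t v) (posY c q₀ N t v) (posE c N t v)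
      (posZ c q₀ N w s) (posY c q₀ N w s) (posE c N w s) := by
  have h0 := congrArg (mink N) hrel
  simp only [mink_add_right, mink_smul_right] at h0
  have e1 : c - q₀ + (q₀ - q) = c - q := by ring
  have e2 : c - q₀ + (q₀ + q) = c + q := by ring
  have e3 : c + q₀ - (q₀ - q) = c + q := by ring
  have e4 : c + q₀ - (q₀ + q) = c - q := by ring
  have h3 : vdet N t v = -vdet N v t := vdet_swap _ _ _
  have h4 : vdet N w s = -vdet N s w := vdet_swap _ _ _
  constructor
  · constructor
    · rw [pos_center, pos_center, e1, e2, e3, e4, h0]; ring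
    · rw [pos_slope, pos_slope, e1, e2, e3, e4, posE]
      linear_combination (-1 / sinh (2 * c)) * h1
    · rw [pos_slope, e1, e3, posE, posE]
      linear_combination (1 / sinh (2 * c)) * h2
  · constructor
    · rw [pos_center, pos_center, e1, e2, e3, e4, add_comm, h0, add_comm]
    · rw [pos_slope, pos_slope, e1, e2, e3, e4, posE, h3]
      linear_combination (1 / sinh (2 * c)) * h1
    · rw [pos_slope, e2, e4, posE, posE, h3, h4]
      linear_combination (-1 / sinh (2 * c)) * h2

/-! ### Bounds at the start of the sweep -/

/-- The difference of the two sides is a convex quadratic in `Y` that vanishes at `cosh (c + q₀) /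
cosh (c - q₀)` with nonnegative derivative there. -/
theorem tilt_bound_aux {c q₀ Y : ℝ} (hq₀ : 0 < q₀) (hqc : q₀ < c)
    (hY : cosh (c + q₀) ≤ Y * cosh (c - q₀)) :
    sinh (2 * q₀) * (2 * (Y * cosh (2 * c)) - 2) ≤
      (Y ^ 2 - 1) * (sinh (2 * c) + sinh (2 * q₀)) := by
  have hs0 : 0 < sinh (2 * q₀) := sinh_pos_iff.2 (by linarith)
  have hS : 0 < sinh (2 * c) := sinh_pos_iff.2 (by linarith)
  have e1 : 2 * c = (c + q₀) + (c - q₀) := by ring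
  have e2 : 2 * q₀ = (c + q₀) - (c - q₀) := by ring
  have hSe := sinh_add (c + q₀) (c - q₀)
  have hCe := cosh_add (c + q₀) (c - q₀)
  have hse := sinh_sub (c + q₀) (c - q₀)
  rw [← e1] at hSe hCe
  rw [← e2] at hse
  have k1 := cosh_sq (c - q₀)
  have k2 := cosh_sq (c + q₀)
  have hca := cosh_pos (c - q₀)
  have hsum : sinh (2 * c) * cosh (2 * q₀) + cosh (2 * c) * sinh (2 * q₀)
      = 2 * sinh (c + q₀) * cosh (c + q₀) := by
    rw [← sinh_add, ← sinh_two_mul]; ring_nf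
  have hc0 := cosh_pos (2 * q₀)
  set ca := cosh (c - q₀)
  set cb := cosh (c + q₀)
  set sa := sinh (c - q₀)
  set sb := sinh (c + q₀)
  set S := sinh (2 * c)
  set C := cosh (2 * c)
  set s₀ := sinh (2 * q₀)
  obtain ⟨δ, hδ, rfl⟩ : ∃ δ, 0 ≤ δ ∧ Y = cb / ca + δ :=
    ⟨Y - cb / ca, sub_nonneg.2 (by rw [div_le_iff₀ hca]; exact hY), by ring⟩
  have hss : S + s₀ = 2 * sb * ca := by rw [hSe, hse]; ring
  have hzero : (cb ^ 2 - ca ^ 2) * (S + s₀) = s₀ * (2 * (cb * C) - 2 * ca) * ca := by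
    rw [hss, hse, hCe]
    linear_combination (2 * ca ^ 3 * sb - 2 * ca ^ 2 * (sb * ca - cb * sa)) * k2
      - 2 * ca * sb * cb ^ 2 * k1
  have hslope : 0 ≤ 2 * (cb / ca * (S + s₀) - s₀ * C) := by
    have : cb / ca * (S + s₀) = 2 * sb * cb := by rw [hss]; field_simp
    rw [this, ← hsum]
    have := mul_pos hS hc0
    linarith
  have hz2 : ((cb / ca) ^ 2 - 1) * (S + s₀) = s₀ * (2 * (cb / ca * C) - 2) := by
    field_simp
    linear_combination hzero
  have : ((cb / ca + δ) ^ 2 - 1) * (S + s₀) - s₀ * (2 * ((cb / ca + δ) * C) - 2)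
      = δ * (2 * (cb / ca * (S + s₀) - s₀ * C)) + δ ^ 2 * (S + s₀) := by
    linear_combination hz2
  have h9 : 0 ≤ δ * (2 * (cb / ca * (S + s₀) - s₀ * C)) + δ ^ 2 * (S + s₀) := by positivity
  linarith

/-- With `-mink a b = y * cosh (2 * c)`, `hside` gives `y - cosh (2 * c) ≤ mink (b - a) t`, which
bounds the position from below and, with `hU`, yields `y ^ 2 - 1 ≤ E ^ 2`. `E` is given only through
its square because exchanging `a` and `b` for the backward run reverses the sign of `posE`. -/
theorem good_start {a b t : ℝ × ℝ × ℝ} {c q₀ E : ℝ} (hq₀ : 0 < q₀) (hqc : q₀ < c)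
    (haa : mink a a = -1) (hbb : mink b b = -1) (htt : mink t t = -1)
    (hbt : mink b t = -cosh (2 * c)) (hside : cosh (2 * c) * mink a t ≤ mink a b)
    (hX : cosh (2 * c) * cosh (c + q₀) ≤ -mink a b * cosh (c - q₀))
    (hE0 : 0 < E) (hE2 : E ^ 2 = posE c (b - a) b t ^ 2)
    (hU : mink (b - a) t ≤ 0) :
    Good (sinh (2 * c)) q₀ (mink (b - a) (b - a)) (posZ c q₀ (b - a) b t)
      (posY c q₀ (b - a) b t) E := by
  have hS : 0 < sinh (2 * c) := sinh_pos_iff.2 (by linarith)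
  have hs0 : 0 < sinh (2 * q₀) := sinh_pos_iff.2 (by linarith)
  have hC : 0 < cosh (2 * c) := cosh_pos _
  have hC2 := cosh_sq (2 * c)
  have hba : mink b a = mink a b := mink_comm _ _
  have hL : mink (b - a) b = -mink a b - 1 := by rw [mink_sub_left, hbb]; ring
  have hUe : mink (b - a) t = -cosh (2 * c) - mink a t := by rw [mink_sub_left, hbt]
  have hNN : mink (b - a) (b - a) = -2 * mink a b - 2 := by
    rw [mink_sub_left, mink_sub_right, mink_sub_right, haa, hbb, hba]; ring
  have hnorm := pos_norm (q₀ := q₀) (b - a) b t (by linarith) hbb htt hbt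
  have hca := cosh_pos (c - q₀)
  have hcle : cosh (c - q₀) ≤ cosh (c + q₀) := cosh_le_cosh.2 (by
    rw [abs_of_pos (by linarith), abs_of_pos (by linarith)]; linarith)
  obtain ⟨y, hy⟩ : ∃ y, -mink a b = y * cosh (2 * c) := ⟨-mink a b / cosh (2 * c), by field_simp⟩
  have hyX : cosh (c + q₀) ≤ y * cosh (c - q₀) := by
    rw [hy] at hX
    nlinarith
  have hy1 : 1 ≤ y := by nlinarith
  have hC1 : 1 < cosh (2 * c) := one_lt_cosh.2 (by linarith)
  have hU0 : y - cosh (2 * c) ≤ mink (b - a) t := by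
    rw [hUe]
    nlinarith
  have hab : mink a b = -(y * cosh (2 * c)) := by linarith
  refine ⟨hE0, ?_, hE2 ▸ hnorm, ?_⟩
  · have hE : y ^ 2 - 1 ≤ posE c (b - a) b t ^ 2 := by
      have h1 := vdet_mul_vdet (b - a) b t (b - a) b t
      rw [hbb, htt, hbt, mink_comm t b, hbt, mink_comm b (b - a), mink_comm t (b - a), hL, hNN,
        hab] at h1
      rw [posE, div_pow, le_div_iff₀ (by positivity)]
      set U := mink (b - a) t
      set C := cosh (2 * c)
      have h2 : 0 ≤ (y - C) ^ 2 - U ^ 2 := by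
        have h3 : 0 ≤ (U - (y - C)) * (-(y - C) - U) :=
          mul_nonneg (by linarith) (by linarith)
        linarith
      have h3 : 0 ≤ 2 * ((y * C - 1) * C * (U - (y - C))) := by
        have : 0 ≤ y * C - 1 := by nlinarith
        have : 0 ≤ U - (y - C) := by linarith
        positivity
      have h4 : vdet (b - a) b t ^ 2 - (y ^ 2 - 1) * sinh (2 * c) ^ 2 =
          ((y - C) ^ 2 - U ^ 2) + 2 * ((y * C - 1) * C * (U - (y - C))) := by
        linear_combination h1 + (y ^ 2 - 1) * hC2
      linarith
    rw [hNN, hab, hE2]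
    refine le_trans ?_ (mul_le_mul_of_nonneg_right hE (by linarith))
    refine le_trans (le_of_eq ?_) (tilt_bound_aux hq₀ hqc hyX)
    ring
  · rw [posZ]
    apply div_nonneg _ hS.le
    rw [hL, hab]
    have e1 : 2 * c = (c - q₀) + (c + q₀) := by ring
    have hsa : 0 < sinh (c - q₀) := sinh_pos_iff.2 (by linarith)
    have hsb : 0 < sinh (c + q₀) := sinh_pos_iff.2 (by linarith)
    have h5 : sinh (c + q₀) * (y - cosh (2 * c)) ≤ sinh (c + q₀) * mink (b - a) t := by gcongr
    refine le_trans ?_ (add_le_add_right h5 _)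
    have h6 : 0 ≤ sinh (2 * c) * (y * cosh (c - q₀) - cosh (c + q₀)) :=
      mul_nonneg hS.le (by linarith)
    have k1 := cosh_sq (c - q₀)
    have k2 := cosh_sq (c + q₀)
    rw [e1, sinh_add] at h6
    rw [e1, cosh_add]
    refine h6.trans (le_of_eq ?_)
    linear_combination (y * sinh (c + q₀)) * k1 - sinh (c - q₀) * k2

/-- Each foot is interior to a side, so all four coefficients in `vdet_cramer` are positive and the
altitudes do cross. The conditions `hvqp` and `hpwq` are weak because `p = q` in a triangle. -/
theorem exists_crossing_swing {v t w s p q : ℝ × ℝ × ℝ} {c α β γ δ : ℝ} (hc : 0 < c)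
    (hα : 0 < α) (hβ : 0 < β) (hγ : 0 < γ) (hδ : 0 < δ)
    (ht : t = α • p + β • w) (hs : s = γ • v + δ • q)
    (hvqw : 0 < vdet v q w) (hpwv : 0 < vdet p w v)
    (hvqp : 0 ≤ vdet v q p) (hpwq : 0 ≤ vdet p w q)
    (hvv : mink v v = -1) (htt : mink t t = -1) (hww : mink w w = -1) (hss : mink s s = -1)
    (hvt : mink v t = -cosh (2 * c)) (hws : mink w s = -cosh (2 * c))
    (hvw : mink v w = cosh (2 * c) * mink t w) (hwv : mink w v = cosh (2 * c) * mink s v)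
    (htw : 1 < -mink t w) :
    ∃ q κ, 0 < q ∧ q < c ∧ -mink t w * cosh (c - q) = cosh (c + q) ∧ 0 < κ ∧
      κ ^ 2 * sinh (2 * c) = sinh (2 * q) ∧ ∀ q₀ N,
      SwingStep (q₀ - q) (q₀ + q) κ (posZ c q₀ N v t) (posY c q₀ N v t) (posE c N v t)
        (posZ c q₀ N s w) (posY c q₀ N s w) (posE c N s w) ∧
      SwingStep (q₀ + q) (q₀ - q) κ (posZ c q₀ N t v) (posY c q₀ N t v) (posE c N t v)
        (posZ c q₀ N w s) (posY c q₀ N w s) (posE c N w s) := by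
  have hC : 0 < cosh (2 * c) := cosh_pos _
  have hvs : mink v s = mink t w := by
    apply mul_left_cancel₀ hC.ne'
    rw [mink_comm v s, ← hwv, mink_comm w v, hvw]
  have hvpw : vdet v p w = vdet p w v := vdet_rotate _ _ _
  have hqpw : vdet q p w = vdet p w q := vdet_rotate _ _ _
  have d1 : vdet v t w = α * vdet v p w := by rw [ht]; simp [vdet]; ring
  have d2 : vdet v s w = δ * vdet v q w := by rw [hs]; simp [vdet]; ring
  have d3 : vdet s t w = α * (γ * vdet v p w + δ * vdet q p w) := by
    rw [ht, hs]; simp [vdet]; ring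
  have d4 : vdet v s t = δ * (α * vdet v q p + β * vdet v q w) := by
    rw [ht, hs]; simp [vdet]; ring
  have hpos : 0 < vdet v t w := by rw [d1, hvpw]; positivity
  have p2 : 0 < vdet v s w := by rw [d2]; positivity
  have p3 : 0 < vdet s t w := by rw [d3, hvpw, hqpw]; positivity
  have p4 : 0 < vdet v s t := by rw [d4]; positivity
  have hrel := (vdet_cramer v t w s).trans (add_comm _ _)
  obtain ⟨x, hx0, hxc, hX, hrel'⟩ := exists_crossing (X := -mink t w) hc p3 p2 hpos htw hrel
    hvv htt hww hss hvt hws (by rw [hvw]; ring) (by ring) (by rw [hvs]; ring)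
  have hsum : c - x + (c + x) = 2 * c := by ring
  have hdiff : c + x - (c - x) = 2 * x := by ring
  obtain ⟨κ, hκ, hκ2, hrot⟩ := crossing_rotation (a := c - x) (b := c + x) (X := -mink t w)
    (by linarith) (by linarith) hX hrel' hvv htt hww hss (by rw [hsum, hvt]) (by rw [hsum, hws])
    (by rw [hsum, hvw]; ring) (by ring) hpos
  rw [hsum, hdiff] at hκ2
  exact ⟨x, κ, hx0, hxc, hX, hκ, hκ2, fun q₀ N =>
    swing_of_crossing q₀ N hrel' (hrot N).1 (hrot N).2⟩

/-- A point on the side of a line that contains `b` is not farther from the line through `t`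
perpendicular to the altitude than the altitude itself allows. -/
theorem side_le {p q b t x : ℝ × ℝ × ℝ} {C : ℝ} (hC : 1 < C)
    (hbb : mink b b = -1) (hbt : mink b t = -C) (hp : mink b p = C * mink t p)
    (hq : mink b q = C * mink t q) (hb : 0 < vdet p q b) (hx : 0 ≤ vdet p q x) :
    C * mink t x ≤ mink b x := by
  have h := congrArg (fun z => mink b z - C * mink t z) (vdet_cramer p q b x)
  simp only [mink_add_right, mink_smul_right, hp, hq, hbb, mink_comm t b, hbt] at h
  have h2 : vdet p q b * (mink b x - C * mink t x) = vdet p q x * (C ^ 2 - 1) := by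
    rw [vdet_swap p x q] at h
    linear_combination -h
  have h3 : 0 ≤ vdet p q b * (mink b x - C * mink t x) := by
    rw [h2]
    exact mul_nonneg hx (by nlinarith)
  linarith [nonneg_of_mul_nonneg_right h3 hb]

/-- The parameter of the symmetric crossing whose base has the length that is to be bounded. -/
theorem exists_extremal_parameter {c : ℝ} (hc : 0 < c) : ∃ q, 0 < q ∧ q < c ∧
    sinh (2 * c) < 3 * sinh (2 * q) ∧
    cosh (c + q) = √(1 + sinh (2 * c) ^ 2 / 3) * cosh (c - q) := by
  have hS : 0 < sinh (2 * c) := sinh_pos_iff.2 (by linarith)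
  -- As `sinh (2 * c) * sinh (2 * q) = cosh (c + q) ^ 2 - cosh (c - q) ^ 2`, the last claim amounts
  -- to the vanishing of this function; `1 < cosh (c - q)` then makes the third claim strict.
  have hcont : ContinuousOn (fun q => 3 * sinh (2 * q) - sinh (2 * c) * cosh (c - q) ^ 2)
      (Set.Icc 0 c) := by fun_prop
  have hcc := cosh_pos c
  obtain ⟨q, ⟨hq0, hqc⟩, hq⟩ := intermediate_value_Ioo hc.le hcont
    (show (0 : ℝ) ∈ _ by
      simp only [mul_zero, sub_zero, sub_self, sinh_zero, cosh_zero, Set.mem_Ioo]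
      constructor
      · have : 0 < sinh (2 * c) * cosh c ^ 2 := by positivity
        linarith
      · linarith)
  simp only at hq
  have h1 : 1 < cosh (c - q) := one_lt_cosh.2 (by linarith)
  have h3 : 0 < sinh (2 * c) * (cosh (c - q) ^ 2 - 1) := mul_pos hS (by nlinarith)
  refine ⟨q, hq0, hqc, by linarith, ?_⟩
  have e1 : 2 * c = (c + q) + (c - q) := by ring
  have e2 : 2 * q = (c + q) - (c - q) := by ring
  have hprod : cosh (c + q) ^ 2 = (1 + sinh (2 * c) ^ 2 / 3) * cosh (c - q) ^ 2 := by
    have h2 : sinh (2 * c) * sinh (2 * q) = cosh (c + q) ^ 2 - cosh (c - q) ^ 2 := by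
      rw [e1, e2, sinh_add (c + q) (c - q), sinh_sub (c + q) (c - q)]
      linear_combination (-cosh (c - q) ^ 2) * cosh_sq (c + q)
        + cosh (c + q) ^ 2 * cosh_sq (c - q)
    linear_combination -h2 + sinh (2 * c) / 3 * hq
  rw [← sqrt_sq (cosh_pos (c - q)).le, ← sqrt_mul (by positivity), ← hprod,
    sqrt_sq (cosh_pos _).le]

/-! ### The cycle of altitudes -/

/-- A cyclic sequence of points of a polygon, each one opposite to a side with the preceding and
the following points as ends, with the feet `t` of the altitudes to these sides. -/
structure AltitudeCycle (n : ℕ) (c : ℝ) (w t : ℕ → ℝ × ℝ × ℝ) : Prop where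
  odd : Odd n
  c_pos : 0 < c
  periodic : ∀ u, w (u + n) = w u
  mink_w : ∀ u, mink (w u) (w u) = -1
  mink_t : ∀ u, mink (t u) (t u) = -1
  altitude : ∀ u, mink (w (u + 1)) (t (u + 1)) = -cosh (2 * c)
  foot_left : ∀ u, mink (w (u + 1)) (w u) = cosh (2 * c) * mink (t (u + 1)) (w u)
  foot_right : ∀ u, mink (w (u + 1)) (w (u + 2)) = cosh (2 * c) * mink (t (u + 1)) (w (u + 2))
  foot_ne : ∀ u, 1 < -mink (t (u + 1)) (w (u + 2))
  foot_mem : ∀ u, ∃ α β : ℝ, 0 < α ∧ 0 < β ∧ t (u + 1) = α • w u + β • w (u + 2)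
  edge : ∀ u k, 0 ≤ vdet (w u) (w (u + 2)) (w k)
  edge_pos : ∀ u, 0 < vdet (w u) (w (u + 2)) (w (u + 1))
  convex : ∀ i j k, i < j → j < k → k < i + n → 0 < vdet (w (2 * i)) (w (2 * j)) (w (2 * k))

theorem AltitudeCycle.step {n : ℕ} {c : ℝ} {w t : ℕ → ℝ × ℝ × ℝ} (h : AltitudeCycle n c w t)
    (u : ℕ) :
    ∃ q κ, 0 < q ∧ q < c ∧ -mink (t (u + 1)) (w (u + 2)) * cosh (c - q) = cosh (c + q) ∧ 0 < κ ∧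
      κ ^ 2 * sinh (2 * c) = sinh (2 * q) ∧ ∀ q₀ N,
      SwingStep (q₀ - q) (q₀ + q) κ (posZ c q₀ N (w (u + 1)) (t (u + 1)))
        (posY c q₀ N (w (u + 1)) (t (u + 1))) (posE c N (w (u + 1)) (t (u + 1)))
        (posZ c q₀ N (t (u + 2)) (w (u + 2))) (posY c q₀ N (t (u + 2)) (w (u + 2)))
        (posE c N (t (u + 2)) (w (u + 2))) ∧
      SwingStep (q₀ + q) (q₀ - q) κ (posZ c q₀ N (t (u + 1)) (w (u + 1)))
        (posY c q₀ N (t (u + 1)) (w (u + 1))) (posE c N (t (u + 1)) (w (u + 1)))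
        (posZ c q₀ N (w (u + 2)) (t (u + 2))) (posY c q₀ N (w (u + 2)) (t (u + 2)))
        (posE c N (w (u + 2)) (t (u + 2))) := by
  obtain ⟨α, β, hα, hβ, ht⟩ := h.foot_mem u
  obtain ⟨γ, δ, hγ, hδ, hs⟩ := h.foot_mem (u + 1)
  exact exists_crossing_swing h.c_pos hα hβ hγ hδ ht hs (h.edge_pos (u + 1)) (h.edge_pos u)
    (h.edge (u + 1) u) (h.edge u (u + 3)) (h.mink_w _) (h.mink_t _) (h.mink_w _) (h.mink_t _)
    (h.altitude u) (h.altitude (u + 1)) (h.foot_right u) (h.foot_left (u + 1)) (h.foot_ne u)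

/-- The maximum of the extremal parameter and the `q u` with `u < m`. The extremal one is admissible
by `hM`; each `q u` is, because `cosh (2 * c) * cosh (c + q u) / cosh (c - q u)` is the hyperbolic
cosine of a distance of two vertices. -/
theorem AltitudeCycle.exists_parameter {n : ℕ} {c M : ℝ} {w t : ℕ → ℝ × ℝ × ℝ}
    (h : AltitudeCycle n c w t) {q : ℕ → ℝ} (hqc : ∀ u, q u < c)
    (hqX : ∀ u, -mink (t (u + 1)) (w (u + 2)) * cosh (c - q u) = cosh (c + q u))
    (hmax : ∀ u, -mink (w (u + 1)) (w (u + 2)) ≤ M)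
    (hM : cosh (2 * c) * √(1 + sinh (2 * c) ^ 2 / 3) ≤ M) (m : ℕ) :
    ∃ q₀, 0 < q₀ ∧ q₀ < c ∧ sinh (2 * c) < 3 * sinh (2 * q₀) ∧
      cosh (2 * c) * cosh (c + q₀) ≤ M * cosh (c - q₀) ∧ ∀ u < m, q u ≤ q₀ := by
  induction m with
  | zero =>
    obtain ⟨x, hx0, hxc, hx3, hx⟩ := exists_extremal_parameter h.c_pos
    refine ⟨x, hx0, hxc, hx3, ?_, by simp⟩
    rw [hx, ← mul_assoc]
    exact mul_le_mul_of_nonneg_right hM (cosh_pos _).le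
  | succ m ih =>
    obtain ⟨x, hx0, hxc, hx3, hx, hle⟩ := ih
    by_cases hm : q m ≤ x
    · refine ⟨x, hx0, hxc, hx3, hx, fun u hu => ?_⟩
      rcases Nat.lt_succ_iff_lt_or_eq.1 hu with h1 | rfl
      exacts [hle u h1, hm]
    · push Not at hm
      refine ⟨q m, by linarith, hqc m, ?_, ?_, fun u hu => ?_⟩
      · have := sinh_lt_sinh.2 (show 2 * x < 2 * q m by linarith)
        linarith
      · rw [← hqX m, ← mul_assoc, mul_neg, ← h.foot_right]
        exact mul_le_mul_of_nonneg_right (hmax m) (cosh_pos _).le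
      · rcases Nat.lt_succ_iff_lt_or_eq.1 hu with h1 | rfl
        exacts [(hle u h1).trans hm.le, le_rfl]

/-- Even indices list the vertices along the boundary, from `w 0` to `w (e + 1)`, which recurs at
the even index `e + 1 + n`. A line separating the ends of this convex arc meets it once;
`vdet_cramer` expresses this. -/
theorem AltitudeCycle.mono {n e : ℕ} {c : ℝ} {w t : ℕ → ℝ × ℝ × ℝ}
    (h : AltitudeCycle n c w t) (he : Even e) (hen : e + 1 < n) {N : ℝ × ℝ × ℝ}
    (ha : mink N (w 0) < 0) (hb : 0 < mink N (w (e + 1))) {k l : ℕ} (hkl : k < l)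
    (hl : 2 * l ≤ e + 1 + n) (hk : 0 ≤ mink N (w (2 * k))) : 0 < mink N (w (2 * l)) := by
  obtain ⟨K, hK⟩ : ∃ K, 2 * K = e + 1 + n := by
    obtain ⟨x, hx⟩ := he
    obtain ⟨y, hy⟩ := h.odd
    exact ⟨x + y + 1, by omega⟩
  have hwK : w (2 * K) = w (e + 1) := by rw [hK, h.periodic]
  rw [← hwK] at hb
  rcases (show l ≤ K by omega).eq_or_lt with rfl | hlK
  · exact hb
  have hk0 : 0 < k := by
    rcases Nat.eq_zero_or_pos k with rfl | h0
    · simp only [mul_zero] at hk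
      linarith
    · exact h0
  have h1 := h.convex k l K hkl hlK (by omega)
  have h2 := h.convex 0 l K (by omega) hlK (by omega)
  have h3 := h.convex 0 k K hk0 (by omega) (by omega)
  have h4 := h.convex 0 k l hk0 hkl (by omega)
  rw [mul_zero] at h2 h3 h4
  have hcr := congrArg (mink N) (vdet_cramer (w 0) (w (2 * k)) (w (2 * K)) (w (2 * l)))
  simp only [mink_add_right, mink_smul_right] at hcr
  have e1 : vdet (w (2 * l)) (w (2 * k)) (w (2 * K)) = -vdet (w (2 * k)) (w (2 * l)) (w (2 * K)) := by
    simp only [vdet]; ring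
  have e2 : vdet (w 0) (w (2 * l)) (w (2 * k)) = -vdet (w 0) (w (2 * k)) (w (2 * l)) :=
    vdet_swap _ _ _
  rw [e1, e2] at hcr
  have s1 : 0 < vdet (w (2 * k)) (w (2 * l)) (w (2 * K)) * -mink N (w 0) :=
    mul_pos h1 (by linarith)
  have s2 := mul_nonneg h2.le hk
  have s4 := mul_pos h4 hb
  have : 0 < vdet (w 0) (w (2 * k)) (w (2 * K)) * mink N (w (2 * l)) := by linarith
  exact pos_of_mul_pos_right this h3.le

theorem AltitudeCycle.lt_bound {n e : ℕ} {c M : ℝ} {w t : ℕ → ℝ × ℝ × ℝ}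
    (h : AltitudeCycle n c w t) (he : Even e) (hen : e + 1 < n)
    (hM : -mink (w 0) (w (e + 1)) = M) (hmax : ∀ u, -mink (w (u + 1)) (w (u + 2)) ≤ M) :
    M < cosh (2 * c) * √(1 + sinh (2 * c) ^ 2 / 3) := by
  by_contra hcon
  push Not at hcon
  have hc := h.c_pos
  have hC1 : 1 < cosh (2 * c) := one_lt_cosh.2 (by positivity)
  choose q κ hq0 hqc hqX hκ hκ2 hswing using h.step
  obtain ⟨q₀, hq₀, hq₀c, hq₀3, hMq, hqle⟩ := h.exists_parameter hqc hqX hmax hcon n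
  have hM1 : 1 < M := by
    have h1 : 1 ≤ √(1 + sinh (2 * c) ^ 2 / 3) := by
      rw [one_le_sqrt]
      have := sq_nonneg (sinh (2 * c))
      linarith
    nlinarith
  set a := w 0 with ha
  set b := w (e + 1) with hb
  set N := b - a with hN
  have haa : mink a a = -1 := h.mink_w _
  have hbb : mink b b = -1 := h.mink_w _
  have hba : mink b a = mink a b := mink_comm _ _
  have hNa : mink N a < 0 := by rw [hN, mink_sub_left, haa, hba]; linarith
  have hNb : 0 < mink N b := by rw [hN, mink_sub_left, hbb]; linarith
  have hwn : w n = a := by have := h.periodic 0; rwa [zero_add] at this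
  set J := n - e - 1 with hJ
  have hJe : Even J := by
    obtain ⟨x, hx⟩ := he
    obtain ⟨y, hy⟩ := h.odd
    exact ⟨y - x, by omega⟩
  set lo : ℕ → ℝ × ℝ × ℝ := fun j => if Even j then w (e + j + 1) else t (e + j + 1) with hlo
  set up : ℕ → ℝ × ℝ × ℝ := fun j => if Even j then t (e + j + 1) else w (e + j + 1) with hup
  have hloup : ∀ j, mink (lo j) (lo j) = -1 ∧ mink (up j) (up j) = -1 ∧
      mink (lo j) (up j) = -cosh (2 * c) := by
    intro j
    by_cases hj : Even j
    · simp only [hlo, hup, hj, if_true]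
      exact ⟨h.mink_w _, h.mink_t _, h.altitude _⟩
    · simp only [hlo, hup, hj, if_false]
      exact ⟨h.mink_t _, h.mink_w _, by rw [mink_comm, h.altitude]⟩
  have hsweep : Sweep c q₀ (mink N N) J (fun j => q (e + j)) (fun j => κ (e + j))
      (fun j => posZ c q₀ N (lo j) (up j)) (fun j => posY c q₀ N (lo j) (up j))
      (fun j => posE c N (lo j) (up j)) := by
    refine ⟨hJe, hq₀c, hq₀3, fun j _ => hq0 _, fun j hj => hqle _ (by omega), fun j _ => hκ _,
      fun j _ => hκ2 _, fun j _ => pos_norm N _ _ hc (hloup j).1 (hloup j).2.1 (hloup j).2.2,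
      fun j _ => ?_⟩
    by_cases hj : Even j
    · have hj1 : ¬ Even (j + 1) := by simpa [Nat.even_add_one] using hj
      simp only [arm, hlo, hup, hj, hj1, if_true, if_false]
      exact (hswing (e + j) q₀ N).1
    · have hj1 : Even (j + 1) := by simpa [Nat.even_add_one] using hj
      simp only [arm, hlo, hup, hj, hj1, if_true, if_false]
      exact (hswing (e + j) q₀ N).2
  have hX : cosh (2 * c) * cosh (c + q₀) ≤ -mink a b * cosh (c - q₀) := by rw [hM]; exact hMq
  have hconv : ∀ k, Even k → 0 < k → k < e + 1 + n → 0 < vdet a (w k) b := by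
    rintro k ⟨x, rfl⟩ hk0 hk
    obtain ⟨y, hy⟩ := he
    obtain ⟨z, hz⟩ := h.odd
    have h1 := h.convex 0 x (y + z + 1) (by omega) (by omega) (by omega)
    rwa [mul_zero, show 2 * (y + z + 1) = e + 1 + n by omega, h.periodic, two_mul] at h1
  have hconv' : ∀ k, Even k → k ≤ e + 1 + n → 0 ≤ vdet a (w k) b := by
    intro k hke hk
    rcases Nat.eq_zero_or_pos k with rfl | hk0
    · exact le_of_eq (by simp only [vdet, ha]; ring)
    · rcases hk.eq_or_lt with rfl | hk1
      · rw [h.periodic]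
        exact le_of_eq (by simp only [vdet, hb]; ring)
      · exact (hconv k hke hk0 hk1).le
  -- The foot is strictly on one side of the line `a b` as soon as an end of its side differs from
  -- `a` and `b`; this makes the tilt positive at both ends of the sweep.
  have hE : ∀ k, Even k → k + 2 ≤ e + 1 + n → (0 < k ∨ k + 2 < e + 1 + n) →
      0 < vdet a (t (k + 1)) b := by
    intro k hke hk hor
    obtain ⟨α, β, hα, hβ, ht⟩ := h.foot_mem k
    have e1 : vdet a (t (k + 1)) b = α * vdet a (w k) b + β * vdet a (w (k + 2)) b := by
      rw [ht]; simp [vdet]; ring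
    have hk2 : Even (k + 2) := by simpa [Nat.even_add] using hke
    have h1 := hconv' k hke (by omega)
    have h2 := hconv' (k + 2) hk2 hk
    rw [e1]
    rcases hor with h3 | h3
    · have := hconv k hke h3 (by omega)
      positivity
    · have := hconv (k + 2) hk2 (by omega) h3
      positivity
  have hlo0 : lo 0 = b := by simp [hlo, hb]
  have hup0 : up 0 = t (e + 1) := by simp [hup]
  have hen' : e + J + 1 = n := by omega
  have hloJ : lo J = a := by simp only [hlo, hJe, if_true, hen', hwn]
  have hupJ : up J = t n := by simp only [hup, hJe, if_true, hen']
  obtain ⟨m, rfl⟩ : ∃ m, n = m + 1 := ⟨n - 1, by omega⟩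
  have hme : Even m := by
    have := h.odd
    rwa [Nat.odd_add_one, Nat.not_odd_iff_even] at this
  refine hsweep.false hq₀ ?_ ?_ ?_ ?_ ?_
  · rw [pos_lower N _ _ hc, hlo0]; exact hNb
  · rw [pos_lower N _ _ hc, hloJ]; exact hNa
  · rw [pos_upper N _ _ hc, hlo0, hup0]
    intro hU
    have hdet0 : 0 < vdet a (t (e + 1)) b := hE e he (by omega) (Or.inr (by omega))
    have e1 : vdet N b (t (e + 1)) = vdet a (t (e + 1)) b := by
      simp only [hN, vdet, Prod.fst_sub, Prod.snd_sub]; ring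
    refine good_start hq₀ hq₀c haa hbb (h.mink_t _) (h.altitude e) ?_ hX ?_ rfl hU
    · rw [mink_comm (w 0), mink_comm (w 0)]
      exact side_le hC1 hbb (h.altitude e) (h.foot_left e) (h.foot_right e) (h.edge_pos e)
        (h.edge e 0)
    · rw [posE, e1]; positivity
  · rw [pos_upper N _ _ hc, hloJ, hupJ]
    intro hU
    have hdet0 : 0 < vdet a (t (m + 1)) b := hE m hme (by omega) (Or.inl (by omega))
    have e1 : vdet N a (t (m + 1)) = vdet a (t (m + 1)) b := by
      simp only [hN, vdet, Prod.fst_sub, Prod.snd_sub]; ring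
    have hZ : -posZ c q₀ N a (t (m + 1)) = posZ c q₀ (a - b) a (t (m + 1)) := by
      rw [hN, posZ, posZ]; simp only [mink_sub_left]; ring
    have hY : -posY c q₀ N a (t (m + 1)) = posY c q₀ (a - b) a (t (m + 1)) := by
      rw [hN, posY, posY]; simp only [mink_sub_left]; ring
    have hE2 : posE c N a (t (m + 1)) ^ 2 = posE c (a - b) a (t (m + 1)) ^ 2 := by
      rw [hN, posE, posE]; simp only [vdet_sub_left]; ring
    have hNN : mink N N = mink (a - b) (a - b) := by
      rw [hN]; simp only [mink_sub_left, mink_sub_right]; ring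
    rw [hZ, hY, hNN]
    have hal := h.altitude m
    have hfl := h.foot_left m
    have hfr := h.foot_right m
    have hep := h.edge_pos m
    rw [hwn] at hal hfl hfr hep
    refine good_start hq₀ hq₀c hbb haa (h.mink_t _) hal ?_ (by rw [hba]; exact hX) ?_ hE2 ?_
    · rw [mink_comm b, mink_comm b]
      exact side_le hC1 haa hal hfl hfr hep (h.edge m (e + 1))
    · rw [posE, e1]; positivity
    · have : mink (a - b) (t (m + 1)) = -mink N (t (m + 1)) := by
        rw [hN]; simp only [mink_sub_left]; ring
      linarith
  · intro j hj
    rw [pos_upper N _ _ hc, pos_upper N _ _ hc]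
    intro hU
    by_cases hje : Even j
    · have hj1 : ¬ Even (j + 1) := by simpa [Nat.even_add_one] using hje
      simp only [hup, hje, hj1, if_true, if_false] at hU ⊢
      obtain ⟨α, β, hα, hβ, ht⟩ := h.foot_mem (e + j)
      obtain ⟨k, hk⟩ := he.add hje
      rw [ht, mink_add_right, mink_smul_right, mink_smul_right] at hU
      by_contra hn
      push Not at hn
      have e1 : e + j + 2 = 2 * (k + 1) := by omega
      have e2 : e + j = 2 * k := by omega
      have e3 : e + (j + 1) + 1 = 2 * (k + 1) := by omega
      rw [e1, e2] at hU
      rw [e3] at hn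
      have h1 : 0 < mink N (w (2 * k)) := by
        by_contra h2
        push Not at h2
        nlinarith
      have := h.mono he hen hNa hNb (lt_add_one k) (by omega) h1.le
      linarith
    · have hj1 : Even (j + 1) := by simpa [Nat.even_add_one] using hje
      simp only [hup, hje, hj1, if_true, if_false] at hU ⊢
      obtain ⟨α, β, hα, hβ, ht⟩ := h.foot_mem (e + (j + 1))
      obtain ⟨k, hk⟩ := he.add hj1
      have e2 : e + (j + 1) = 2 * k := by omega
      have e1 : e + (j + 1) + 2 = 2 * (k + 1) := by omega
      rw [ht, mink_add_right, mink_smul_right, mink_smul_right, e1, e2]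
      rw [show e + j + 1 = 2 * k by omega] at hU
      have := h.mono he hen hNa hNb (lt_add_one k) (by omega) hU.le
      positivity

/-! ### Distances, convex hulls and feet on the hyperboloid -/

/-- A point of the hyperboloid as a vector. -/
def vec (p : HypPlane) : ℝ × ℝ × ℝ := (p.x, p.y, p.t)

theorem mink_vec (p q : HypPlane) : mink (vec p) (vec q) = -lorentz p q := by
  simp only [mink, vec, lorentz]; ring

theorem vdet_vec (p q r : HypPlane) : vdet (vec p) (vec q) (vec r) = det p q r := rfl

theorem lorentz_comm (p q : HypPlane) : lorentz p q = lorentz q p := by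
  simp only [lorentz]; ring

theorem lorentz_self (p : HypPlane) : lorentz p p = 1 := by
  have := p.t_sq
  simp only [lorentz]; linarith

theorem one_le_lorentz (p q : HypPlane) : 1 ≤ lorentz p q := by
  have h1 := p.t_sq
  have h2 := q.t_sq
  have h3 : (1 + p.x * q.x + p.y * q.y) ^ 2 ≤ (p.t * q.t) ^ 2 := by
    rw [mul_pow, h1, h2]
    nlinarith [sq_nonneg (p.x - q.x), sq_nonneg (p.y - q.y), sq_nonneg (p.x * q.y - p.y * q.x)]
  have h4 := abs_le_of_sq_le_sq h3 (mul_pos p.t_pos q.t_pos).le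
  simp only [lorentz]
  linarith [le_abs_self (1 + p.x * q.x + p.y * q.y)]

theorem cosh_dist (p q : HypPlane) : cosh (dist p q) = lorentz p q := by
  rw [dist_def, cosh_arcosh (one_le_lorentz p q)]

theorem one_lt_lorentz {p q : HypPlane} (h : p ≠ q) : 1 < lorentz p q := by
  rw [← cosh_dist]
  exact one_lt_cosh.2 (dist_ne_zero.2 h)

theorem dist_le_iff {p q r s : HypPlane} : dist p q ≤ dist r s ↔ lorentz p q ≤ lorentz r s := by
  rw [← cosh_dist, ← cosh_dist, cosh_le_cosh, abs_of_nonneg dist_nonneg, abs_of_nonneg dist_nonneg]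

/-- A point `a q + b r` of the hyperboloid has `a + b ≤ 1`, since `lorentz q r` is at least `1`. -/
theorem isConvex_closedBall (p : HypPlane) (M : ℝ) : IsConvex {r | lorentz p r ≤ M} := by
  rintro q hq r hr z ⟨a, b, ha, hb, hx, hy, ht⟩
  simp only [Set.mem_ofPred_eq] at hq hr ⊢
  have hM : 0 ≤ M := by linarith [one_le_lorentz p q]
  have h1 : lorentz p z = a * lorentz p q + b * lorentz p r := by
    simp only [lorentz, hx, hy, ht]; ring
  have h2 : a ^ 2 + b ^ 2 + 2 * a * b * lorentz q r = 1 := by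
    rw [← lorentz_self z]
    have e1 := lorentz_self q
    have e2 := lorentz_self r
    simp only [lorentz, hx, hy, ht] at e1 e2 ⊢
    linear_combination (-a ^ 2) * e1 - b ^ 2 * e2
  have h3 : a + b ≤ 1 := by
    have := mul_nonneg (mul_nonneg ha hb) (sub_nonneg.2 (one_le_lorentz q r))
    nlinarith
  rw [h1]
  nlinarith [mul_le_mul_of_nonneg_left hq ha, mul_le_mul_of_nonneg_left hr hb]

theorem hull_subset {S K : Set HypPlane} (hK : IsConvex K) (h : S ⊆ K) : hull S ⊆ K :=
  Set.sInter_subset_of_mem ⟨hK, h⟩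

theorem lorentz_le_of_mem_hull {S : Set HypPlane} {M : ℝ}
    (h : ∀ p ∈ S, ∀ q ∈ S, lorentz p q ≤ M) {p q : HypPlane} (hp : p ∈ hull S)
    (hq : q ∈ hull S) : lorentz p q ≤ M := by
  have h1 : ∀ s ∈ S, hull S ⊆ {r | lorentz s r ≤ M} := fun s hs =>
    hull_subset (isConvex_closedBall s M) (fun r hr => h s hs r hr)
  have h2 : hull S ⊆ {r | lorentz p r ≤ M} :=
    hull_subset (isConvex_closedBall p M) (fun r hr => by
      rw [Set.mem_ofPred_eq, lorentz_comm]; exact h1 r hr hp)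
  exact h2 hq

/-- The normalization of a future timelike vector. -/
noncomputable def ofTimelike (x y t : ℝ) (ht : 0 < t) (h : x ^ 2 + y ^ 2 < t ^ 2) : HypPlane where
  x := x / √(t ^ 2 - x ^ 2 - y ^ 2)
  y := y / √(t ^ 2 - x ^ 2 - y ^ 2)
  t := t / √(t ^ 2 - x ^ 2 - y ^ 2)
  sheet := by
    have h1 : 0 < t ^ 2 - x ^ 2 - y ^ 2 := by linarith
    have h2 := sqrt_pos.2 h1
    symm
    rw [sqrt_eq_iff_mul_self_eq (by positivity) (by positivity)]
    field_simp
    rw [sq_sqrt h1.le]; ring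

theorem eq_zero_of_quadratic_nonneg {k m δ : ℝ} (hδ : 0 < δ)
    (h : ∀ ε, |ε| < δ → 0 ≤ k * ε + m * ε ^ 2) : k = 0 := by
  by_contra hk
  have hk' := abs_pos.2 hk
  set η := min (δ / 2) (|k| / (2 * (|m| + 1))) with hη
  have hη0 : 0 < η := lt_min (by linarith) (by positivity)
  have hη1 : η < δ := (min_le_left _ _).trans_lt (by linarith)
  have hη2 : η * (2 * (|m| + 1)) ≤ |k| := by
    rw [← le_div_iff₀ (by positivity)]; exact min_le_right _ _
  have hm : m ≤ |m| := le_abs_self m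
  have key : k * (-(SignType.sign k : ℝ) * η) = -(|k| * η) := by
    rw [← self_mul_sign]; ring
  have hs : ((SignType.sign k : ℝ)) ^ 2 = 1 := by
    rcases lt_or_gt_of_ne hk with h1 | h1
    · simp [sign_neg h1]
    · simp [sign_pos h1]
  have habs : |-(SignType.sign k : ℝ) * η| = η := by
    rw [abs_mul, abs_neg, abs_of_pos hη0, ← sq_abs] at *
    have : |(SignType.sign k : ℝ)| = 1 := by
      have := abs_nonneg (SignType.sign k : ℝ)
      nlinarith
    rw [this, one_mul]
  have h1 := h (-(SignType.sign k : ℝ) * η) (by rw [habs]; exact hη1)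
  rw [key, mul_pow, neg_sq, hs, one_mul] at h1
  have h2 : m * η ^ 2 ≤ |m| * η ^ 2 := by gcongr
  have h3 : |m| * η < |k| := by
    have := abs_nonneg m
    nlinarith
  nlinarith

/-- The first-order condition at the nearest point `f`, tested on the normalized vectors `f + ε p`;
it is Pythagoras' theorem for the right angle at `f`. -/
theorem foot_orthogonal_aux {z f p : HypPlane} {L : Set HypPlane} (hf : IsProjection z L f)
    (hL : ∀ (r : HypPlane) (a b : ℝ), r.x = a * f.x + b * p.x → r.y = a * f.y + b * p.y →
      r.t = a * f.t + b * p.t → r ∈ L) :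
    lorentz z p = lorentz z f * lorentz f p := by
  have hmin : ∀ r ∈ L, lorentz z f ≤ lorentz z r := by
    intro r hr
    rw [← dist_le_iff, hf.2]
    exact Metric.infDist_le_dist_of_mem hr
  have hA := one_le_lorentz z f
  have hl := one_le_lorentz f p
  have hft := f.t_pos
  have hpt := p.t_pos
  have hff := lorentz_self f
  have hpp := lorentz_self p
  have h : 2 * lorentz z f * (lorentz z p - lorentz z f * lorentz f p) = 0 := by
    refine eq_zero_of_quadratic_nonneg (m := lorentz z p ^ 2 - lorentz z f ^ 2)
      -- The first bound keeps `f + ε p` timelike, the second keeps it on the upper sheet.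
      (δ := min (1 / (2 * lorentz f p)) (f.t / p.t)) (lt_min (by positivity) (by positivity)) ?_
    intro ε hε
    have hε1 := hε.trans_le (min_le_left _ _)
    have hε2 := hε.trans_le (min_le_right _ _)
    rw [lt_div_iff₀ (by positivity)] at hε1 hε2
    have hεa := neg_abs_le ε
    have hQ : 0 < 1 + 2 * ε * lorentz f p + ε ^ 2 := by nlinarith [sq_nonneg ε]
    have ht : 0 < f.t + ε * p.t := by nlinarith
    have hQe : (f.t + ε * p.t) ^ 2 - (f.x + ε * p.x) ^ 2 - (f.y + ε * p.y) ^ 2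
        = 1 + 2 * ε * lorentz f p + ε ^ 2 := by
      simp only [lorentz] at hff hpp ⊢
      linear_combination hff + ε ^ 2 * hpp
    have hr := hmin (ofTimelike (f.x + ε * p.x) (f.y + ε * p.y) (f.t + ε * p.t) ht (by linarith))
      (hL _ (1 / √(1 + 2 * ε * lorentz f p + ε ^ 2)) (ε / √(1 + 2 * ε * lorentz f p + ε ^ 2))
        (by simp only [ofTimelike, hQe]; ring) (by simp only [ofTimelike, hQe]; ring)
        (by simp only [ofTimelike, hQe]; ring))
    have hsq := sqrt_pos.2 hQ
    have hlr : lorentz z (ofTimelike (f.x + ε * p.x) (f.y + ε * p.y) (f.t + ε * p.t) ht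
        (by linarith)) = (lorentz z f + ε * lorentz z p) / √(1 + 2 * ε * lorentz f p + ε ^ 2) := by
      simp only [lorentz, ofTimelike]
      simp only [hQe, lorentz]; ring
    rw [hlr, le_div_iff₀ hsq] at hr
    have hr2 : (lorentz z f * √(1 + 2 * ε * lorentz f p + ε ^ 2)) ^ 2
        ≤ (lorentz z f + ε * lorentz z p) ^ 2 := by gcongr
    rw [mul_pow, sq_sqrt hQ.le] at hr2
    linarith
  have h0 : 2 * lorentz z f ≠ 0 := by positivity
  have := (mul_eq_zero.1 h).resolve_left h0
  linarith

theorem foot_orthogonal {z p q f : HypPlane} (hf : IsProjection z (lineThrough p q) f) :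
    lorentz z p = lorentz z f * lorentz f p ∧ lorentz z q = lorentz z f * lorentz f q := by
  have h0 : det p q f = 0 := hf.1
  constructor
  · refine foot_orthogonal_aux hf fun r a b hx hy ht => ?_
    have : det p q r = a * det p q f := by simp only [det, hx, hy, ht]; ring
    change det p q r = 0
    rw [this, h0, mul_zero]
  · refine foot_orthogonal_aux hf fun r a b hx hy ht => ?_
    have : det p q r = a * det p q f := by simp only [det, hx, hy, ht]; ring
    change det p q r = 0
    rw [this, h0, mul_zero]

/-! ### From the convex polygon to the cycle of altitudes -/

theorem natCast_ne_zero {n k : ℕ} (h0 : 0 < k) (hk : k < n) : (k : ZMod n) ≠ 0 := by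
  rw [Ne, ZMod.natCast_eq_zero_iff]
  exact Nat.not_dvd_of_pos_of_lt h0 hk

theorem IsConvexPolygon.edge_nonneg {n : ℕ} {v : ZMod n → HypPlane} (h : IsConvexPolygon v)
    (i j : ZMod n) : 0 ≤ det (v i) (v (i + 1)) (v j) := by
  by_cases h1 : j = i
  · subst h1; exact le_of_eq (by simp only [det]; ring)
  by_cases h2 : j = i + 1
  · subst h2; exact le_of_eq (by simp only [det]; ring)
  exact (h.successive i j h1 h2).le

/-- Three vertices of a convex polygon in positive order form a positively oriented triangle. -/
theorem IsConvexPolygon.det_pos {n : ℕ} {v : ZMod n → HypPlane} (h : IsConvexPolygon v)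
    (i : ZMod n) {j k : ℕ} (hj : 0 < j) (hjk : j < k) (hk : k < n) :
    0 < det (v i) (v (i + j)) (v (i + k)) := by
  have hfan : ∀ l : ℕ, 1 < l → l < n → 0 < det (v i) (v (i + 1)) (v (i + l)) := by
    intro l h1 h2
    apply h.successive
    · simpa using natCast_ne_zero (by omega) h2
    · intro hc
      have : ((l - 1 : ℕ) : ZMod n) = 0 := by
        rw [Nat.cast_sub h1.le]
        have := add_left_cancel hc
        rw [this]; simp
      exact natCast_ne_zero (by omega) (by omega) this
  have hside : ∀ l : ℕ, 0 < l → l + 1 < n → 0 < det (v i) (v (i + l)) (v (i + (l + 1 : ℕ))) := by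
    intro l h1 h2
    have h3 := h.successive (i + l) i
      (by simpa using (natCast_ne_zero h1 (by omega)))
      (by
        intro hc
        apply natCast_ne_zero (show 0 < l + 1 by omega) h2
        have : i + ((l + 1 : ℕ) : ZMod n) = i + 0 := by
          rw [add_zero]; push_cast; rw [← add_assoc]; exact hc.symm
        exact add_left_cancel this)
    have e : i + (l : ZMod n) + 1 = i + ((l + 1 : ℕ) : ZMod n) := by push_cast; ring
    rw [e] at h3
    have : det (v i) (v (i + l)) (v (i + (l + 1 : ℕ)))
        = det (v (i + l)) (v (i + (l + 1 : ℕ))) (v i) := by simp only [det]; ring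
    rw [this]; exact h3
  rcases (show 1 ≤ j from hj).eq_or_lt with rfl | hj1
  · have := hfan k hjk hk
    simpa using this
  induction k, (show j + 1 ≤ k from hjk) using Nat.le_induction with
  | base => exact hside j hj hk
  | succ k hjk' ih =>
    have h1 := ih (by omega) (by omega)
    have h2 := hfan k (by omega) (by omega)
    have h3 := hfan j hj1 (by omega)
    have h4 := hfan (k + 1) (by omega) hk
    have h5 := hside k (by omega) hk
    -- The three-term Plücker relation for the four vectors seen from `v i`.
    have key : det (v i) (v (i + 1)) (v (i + k)) * det (v i) (v (i + j)) (v (i + (k + 1 : ℕ))) =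
        det (v i) (v (i + 1)) (v (i + j)) * det (v i) (v (i + k)) (v (i + (k + 1 : ℕ))) +
        det (v i) (v (i + 1)) (v (i + (k + 1 : ℕ))) * det (v i) (v (i + j)) (v (i + k)) := by
      simp only [det]; ring
    have h6 := add_pos (mul_pos h3 h5) (mul_pos h4 h1)
    rw [← key] at h6
    exact pos_of_mul_pos_right h6 h2.le

/-- The vertices of a polygon with `2 * m + 1` vertices, listed so that each one is opposite to the
side between its neighbours in the list. -/
theorem IsConvexPolygon.altitudeCycle {n m : ℕ} {v f : ZMod n → HypPlane} {Δ : ℝ}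
    (hv : IsConvexPolygon v) (hn : n = 2 * m + 1)
    (hf : ∀ i : ZMod n, IsProjection (v i) (lineThrough (v (i + m)) (v (i + m + 1))) (f i))
    (hmem : ∀ i : ZMod n, f i ∈ openSegment (v (i + m)) (v (i + m + 1)))
    (hΔ : ∀ i, dist (v i) (f i) = Δ) (i₀ : ZMod n) :
    AltitudeCycle n (Δ / 2) (fun u => vec (v (i₀ + (m + 1) * u)))
      (fun u => vec (f (i₀ + (m + 1) * u))) := by
  have h3 := hv.three_le
  -- So `m + 1` is half of `1` modulo `n`: two steps of the list lead to the next vertex of the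
  -- polygon.
  have h0 : 2 * (m : ZMod n) + 1 = 0 := by
    have : ((2 * m + 1 : ℕ) : ZMod n) = 0 := by rw [← hn]; exact ZMod.natCast_self n
    exact_mod_cast this
  have hm0 : (m : ZMod n) ≠ 0 := natCast_ne_zero (by omega) (by omega)
  have hm1 : (m : ZMod n) + 1 ≠ 0 := by
    have := natCast_ne_zero (show 0 < m + 1 by omega) (show m + 1 < n by omega)
    exact_mod_cast this
  have hstrict : ∀ i : ZMod n, 0 < det (v i) (v (i + 1)) (v (i + (m + 1))) := by
    intro i
    apply hv.successive
    · simpa using hm1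
    · intro hc
      exact hm0 (by linear_combination hc)
  have hopp : ∀ i : ZMod n, 0 < det (v (i + m)) (v (i + m + 1)) (v i) := by
    intro i
    have := hstrict (i + m)
    rwa [show i + (m : ZMod n) + (m + 1) = i by linear_combination h0] at this
  have hΔ2 : 2 * (Δ / 2) = Δ := by ring
  have halt : ∀ i, lorentz (v i) (f i) = cosh Δ := fun i => by rw [← cosh_dist, hΔ]
  have horth := fun i => foot_orthogonal (hf i)
  have hleft : ∀ u : ℕ, i₀ + ((m : ZMod n) + 1) * ((u + 1 : ℕ) : ZMod n) + m
      = i₀ + (m + 1) * u := by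
    intro u; push_cast; linear_combination h0
  have hright : ∀ u : ℕ, i₀ + ((m : ZMod n) + 1) * ((u + 1 : ℕ) : ZMod n) + m + 1
      = i₀ + (m + 1) * (u + 2 : ℕ) := by
    intro u; push_cast; linear_combination 0 * h0
  have hnext : ∀ u : ℕ, i₀ + ((m : ZMod n) + 1) * ((u + 2 : ℕ) : ZMod n)
      = i₀ + (m + 1) * u + 1 := by
    intro u; push_cast; linear_combination h0
  have hdouble : ∀ k : ℕ, i₀ + ((m : ZMod n) + 1) * ((2 * k : ℕ) : ZMod n) = i₀ + k := by
    intro k; push_cast; linear_combination (k : ZMod n) * h0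
  have hseg : ∀ i : ZMod n, ∃ α β : ℝ, 0 < α ∧ 0 < β ∧
      vec (f i) = α • vec (v (i + m)) + β • vec (v (i + m + 1)) := by
    intro i
    obtain ⟨α, β, hα, hβ, hx, hy, ht⟩ := hmem i
    exact ⟨α, β, hα, hβ, by ext <;> simp [vec, hx, hy, ht]⟩
  have hne : ∀ i : ZMod n, f i ≠ v (i + m + 1) := by
    intro i hc
    obtain ⟨α, β, hα, -, hx, hy, ht⟩ := hmem i
    have h1 : det (f i) (v (i + m + 1)) (v i)
        = α * det (v (i + m)) (v (i + m + 1)) (v i) := by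
      simp only [det, hx, hy, ht]; ring
    have h2 : det (f i) (v (i + m + 1)) (v i) = 0 := by
      rw [hc]; simp only [det]; ring
    rw [h2] at h1
    have := mul_pos hα (hopp i)
    linarith
  have hpos : 0 < Δ := by
    have h1 : 0 ≤ Δ := hΔ i₀ ▸ dist_nonneg
    rcases h1.eq_or_lt with h2 | h2
    · have h4 : v i₀ = f i₀ := dist_eq_zero.1 ((hΔ i₀).trans h2.symm)
      have h5 : det (v (i₀ + m)) (v (i₀ + m + 1)) (f i₀) = 0 := (hf i₀).1
      have := hopp i₀
      rw [h4] at this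
      linarith
    · exact h2
  refine ⟨⟨m, hn⟩, by linarith, fun u => ?_, fun u => ?_, fun u => ?_, fun u => ?_,
    fun u => ?_, fun u => ?_, fun u => ?_, fun u => ?_, fun u k => ?_, fun u => ?_,
    fun i j k hij hjk hk => ?_⟩
  · simp only [Nat.cast_add, ZMod.natCast_self, add_zero]
  · simp only [mink_vec, lorentz_self]
  · simp only [mink_vec, lorentz_self]
  · simp only [mink_vec, halt, hΔ2]
  · have h1 := (horth (i₀ + (m + 1) * ((u + 1 : ℕ) : ZMod n))).1
    rw [halt, hleft] at h1
    simp only [mink_vec, hΔ2, h1]; ring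
  · have h1 := (horth (i₀ + (m + 1) * ((u + 1 : ℕ) : ZMod n))).2
    rw [halt, hright] at h1
    simp only [mink_vec, hΔ2, h1]; ring
  · simp only [mink_vec, neg_neg]
    have := hne (i₀ + (m + 1) * ((u + 1 : ℕ) : ZMod n))
    rw [hright] at this
    exact one_lt_lorentz this
  · have := hseg (i₀ + (m + 1) * ((u + 1 : ℕ) : ZMod n))
    rwa [hright, hleft] at this
  · simp only [vdet_vec, hnext]
    exact hv.edge_nonneg _ _
  · simp only [vdet_vec, hnext]
    have := hstrict (i₀ + (m + 1) * u)
    rwa [show i₀ + ((m : ZMod n) + 1) * u + (m + 1) = i₀ + (m + 1) * ((u + 1 : ℕ) : ZMod n) by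
      push_cast; ring] at this
  · simp only [vdet_vec, hdouble]
    have := hv.det_pos (i₀ + i) (j := j - i) (k := k - i) (by omega) (by omega) (by omega)
    rw [Nat.cast_sub hij.le, Nat.cast_sub (by omega)] at this
    simpa only [add_add_sub_cancel, add_assoc, add_sub_cancel] using this

theorem IsConvexPolygon.lorentz_lt {n m : ℕ} {v f : ZMod n → HypPlane} {Δ : ℝ}
    (hv : IsConvexPolygon v) (hn : n = 2 * m + 1)
    (hf : ∀ i : ZMod n, IsProjection (v i) (lineThrough (v (i + m)) (v (i + m + 1))) (f i))
    (hmem : ∀ i : ZMod n, f i ∈ openSegment (v (i + m)) (v (i + m + 1)))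
    (hΔ : ∀ i, dist (v i) (f i) = Δ) (i j : ZMod n)
    (hmax : ∀ k l, lorentz (v k) (v l) ≤ lorentz (v i) (v j)) :
    lorentz (v i) (v j) < √(1 + sinh Δ ^ 2 / 3) * cosh Δ := by
  have h3 := hv.three_le
  have h0 : 2 * (m : ZMod n) + 1 = 0 := by
    have : ((2 * m + 1 : ℕ) : ZMod n) = 0 := by rw [← hn]; exact ZMod.natCast_self n
    exact_mod_cast this
  have key : ∀ (i₀ : ZMod n) (e : ℕ), Even e → e + 1 < n →
      (∀ k l, lorentz (v k) (v l) ≤ lorentz (v i₀) (v (i₀ + (m + 1) * (e + 1 : ℕ)))) →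
      lorentz (v i₀) (v (i₀ + (m + 1) * (e + 1 : ℕ))) < √(1 + sinh Δ ^ 2 / 3) * cosh Δ := by
    intro i₀ e he hen hmax'
    have hcyc := hv.altitudeCycle hn hf hmem hΔ i₀
    have := hcyc.lt_bound he hen rfl (fun u => by
      simp only [mink_vec, neg_neg, Nat.cast_zero, mul_zero, add_zero]
      exact hmax' _ _)
    simp only [mink_vec, neg_neg, Nat.cast_zero, mul_zero, add_zero] at this
    rwa [show 2 * (Δ / 2) = Δ by ring, mul_comm (cosh Δ)] at this
  have hn0 : NeZero n := ⟨by omega⟩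
  obtain ⟨k, hkn, hj⟩ : ∃ k : ℕ, k < n ∧ j = i + k := by
    refine ⟨(j - i).val, ZMod.val_lt _, ?_⟩
    rw [ZMod.natCast_zmod_val]; ring
  rcases Nat.eq_zero_or_pos k with hk0 | hk0
  · rw [hk0, Nat.cast_zero, add_zero] at hj
    have h1 := hmax i (i + 1)
    have h2 : v i ≠ v (i + 1) := by
      intro hc
      have h4 := hv.det_pos i (j := 1) (k := 2) one_pos one_lt_two (by omega)
      rw [Nat.cast_one, ← hc] at h4
      have : det (v i) (v i) (v (i + (2 : ℕ))) = 0 := by simp only [det]; ring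
      linarith
    have h4 := one_lt_lorentz h2
    rw [hj, lorentz_self] at h1
    linarith
  -- From `i` to `j` the list advances by `2 * k` modulo `n`. As `n` is odd, exactly one order of
  -- the two vertices gives an odd advance `e + 1 < n`.
  rcases lt_or_ge (2 * k) n with hk | hk
  · have e1 : i = j + (m + 1) * ((n - 2 * k - 1 + 1 : ℕ) : ZMod n) := by
      rw [show n - 2 * k - 1 + 1 = n - 2 * k by omega, Nat.cast_sub hk.le, ZMod.natCast_self, hj]
      push_cast
      linear_combination (k : ZMod n) * h0
    have := key j (n - 2 * k - 1) ⟨m - k, by omega⟩ (by omega)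
      (by rw [← e1, lorentz_comm (v j)]; exact hmax)
    rwa [← e1, lorentz_comm (v j)] at this
  · have e1 : j = i + (m + 1) * ((2 * k - n - 1 + 1 : ℕ) : ZMod n) := by
      rw [show 2 * k - n - 1 + 1 = 2 * k - n by omega, Nat.cast_sub hk, ZMod.natCast_self, hj]
      push_cast
      linear_combination -(k : ZMod n) * h0
    have := key i (2 * k - n - 1) ⟨k - m - 1, by omega⟩ (by omega) (by rw [← e1]; exact hmax)
    rwa [← e1] at this

end HypPlane

theorem theorem3 (V : Set HypPlane) (hV : HypPlane.IsOrdinaryReducedPolygon V) :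
    Metric.diam V <
      Real.arcosh (√(1 + Real.sinh (HypPlane.thickness V) ^ 2 / 3) *
        Real.cosh (HypPlane.thickness V)) := by
  obtain ⟨n, v, ⟨m, hn⟩, hv, hVe, h⟩ := hV
  have h3 := hv.three_le
  have hn0 : NeZero n := ⟨by omega⟩
  have e1 : (n - 1) / 2 = m := by omega
  have e2 : (n + 1) / 2 = m + 1 := by omega
  simp only [e1, e2, Nat.cast_add, Nat.cast_one, ← add_assoc] at h
  choose hfoot hdist using h
  choose f hf hmem using hfoot
  have hΔ : ∀ i, dist (v i) (f i) = HypPlane.thickness V := fun i => by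
    rw [(hf i).2, hdist]
  obtain ⟨⟨i, j⟩, hmax⟩ :=
    Finite.exists_max (fun p : ZMod n × ZMod n => HypPlane.lorentz (v p.1) (v p.2))
  have hlt := hv.lorentz_lt hn hf hmem hΔ i j (fun k l => hmax (k, l))
  have h1 := HypPlane.one_le_lorentz (v i) (v j)
  refine lt_of_le_of_lt (Metric.diam_le_of_forall_dist_le (C := Real.arcosh
    (HypPlane.lorentz (v i) (v j))) (Real.arcosh_nonneg h1) ?_)
    ((Real.arcosh_lt_arcosh (by linarith) (by linarith)).2 hlt)
  intro p hp q hq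
  rw [hVe] at hp hq
  rw [HypPlane.dist_def, Real.arcosh_le_arcosh
    (by linarith [HypPlane.one_le_lorentz p q]) (by linarith)]
  refine HypPlane.lorentz_le_of_mem_hull ?_ hp hq
  rintro _ ⟨k, rfl⟩ _ ⟨l, rfl⟩
  exact hmax (k, l)
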